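/- Let $F_0$ be a complete discretely valued field with ring of integers $O_{F_0}$ and perfect residue field of characteristic $\neq 2$, let $F/F_0$ be a ramified quadratic extension with ring of integers $O_F$, and let $\pi_0\in F_0$, $\pi\in F$ be uniformizers with $\pi^2=\pi_0$. Let $n=2m>3$, let $n=r+s$ with $s\le r$, and let $V=F^n$ carry the split $F/F_0$-hermitian form $\phi$ with $\phi(e_i,e_{n+1-j})=\delta_{ij}$. Put $(x,y)=\tfrac12\mathrm{Tr}_{F/F_0}\phi(x,y)$, let $b_i=\pi^{-1}e_i$ for $i\le m$ and $b_i=e_i$ for $i>m$, let $\Lambda_m=\mathrm{span}_{O_F}\{b_1,\dots,b_n\}$ (self-dual for $(\,,\,)$), and let $t$ be multiplication by $\pi$ on $\Lambda_m$, so that $b_1,\dots,b_n,tb_1,\dots,tb_n$ is an $O_{F_0}$-basis of $\Lambda_m$. The naive splitting model $\mathcal M$ is the $O_F$-scheme whose points over an $O_F$-scheme $S$ are the pairs of Zariski locally direct summands $\mathcal F_0\subset\mathcal F_1\subset\Lambda_m\otimes_{O_{F_0}}\mathcal O_S$ of ranks $s$ and $n$ with $\mathcal F_1=\mathcal F_1^\perp$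 for $(\,,\,)$, $(t+\pi)\mathcal F_1\subset\mathcal F_0$ and $(t-\pi)\mathcal F_0=0$. For distinct indices $i_1,\dots,i_s\in\{1,\dots,n\}$ let $$R_{(i_k)}=O_F[D,Y]\big/\big(Y'-I_s,\ D+D^t,\ D\cdot Q+2\pi I_s\big),$$ where $D$ is an $s\times s$ matrix and $Y$ an $n\times s$ matrix of indeterminates, $Y'$ is the matrix formed by the rows $i_1,\dots,i_s$ of $Y$, $Q=\widetilde Y^tY$, and $\widetilde Y$ is the $n\times s$ matrix whose rows are $y_n,\dots,y_{m+1},-y_m,\dots,-y_1$, where $y_j$ denotes the $j$-th row of $Y$. Then, for every choice of $i_1,\dots,i_s$, the points $(\mathcal F_0,\mathcal F_1)$ of $\mathcal M$ such that $\mathcal F_1$ is a complement of the span of $b_1,\dots,b_n$, and $\mathcal F_0$ is a complement of the span of $b_1,\dots,b_n$ and the $tb_j$ with $j\notin\{i_1,\dots,i_s\}$, form an open subfunctor of (the functor of points of) $\mathcal M$ which is represented by $\mathrm{Spec}\,R_{(i_k)}$. In particular $\mathcal M$ has an open subscheme, consisting of these points, which is isomorphic to $\mathrm{Spec}\,R_{(i_k)}$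 over $O_F$. These are affine charts around the points $(\mathcal F_0,t\Lambda_m)$: over every field over $O_F$ in which $\pi=0$, each of them contains a point with $\mathcal F_1=t\Lambda_m$, and every point $(\mathcal F_0,t\Lambda_m)$ of $\mathcal M$ with values in a field lies in the chart of some choice of $i_1,\dots,i_s$. -/

import Mathlib

open scoped TensorProduct
open CategoryTheory AlgebraicGeometry

universe u

namespace NaiveSplitting

/-! ### The ramified quadratic extension -/

/-- The ring of integers `O_F` of `F`: the integral closure of `O = O_{F₀}` in `F`. -/
abbrev IntRing (O F : Type u) [CommRing O] [Field F] [Algebra O F] : Type u :=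
  ↥(integralClosure O F)

/-- The arithmetic data: `O = O_{F₀}` is the ring of integers of a complete discretely valued field
`F₀` with perfect residue field of characteristic different from two, `F / F₀` is a ramified
quadratic extension, `π₀` and `π` are uniformizers with `π ^ 2 = π₀`, and `σ` is the nontrivial
automorphism of `F` over `F₀`. -/
structure RamifiedQuadratic (O F₀ F : Type u)
    [CommRing O] [IsDomain O] [IsDiscreteValuationRing O] [Field F₀] [Algebra O F₀]
    [IsFractionRing O F₀] [Field F] [Algebra F₀ F] [Algebra O F] [IsScalarTower O F₀ F] where
  complete : IsAdicComplete (IsLocalRing.maximalIdeal O) O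
  perfect : PerfectField (IsLocalRing.ResidueField O)
  residue_two : (2 : IsLocalRing.ResidueField O) ≠ 0
  finrank_eq : Module.finrank F₀ F = 2
  π₀ : O
  irreducible_π₀ : Irreducible π₀
  π : IntRing O F
  π_sq : π ^ 2 = algebraMap O (IntRing O F) π₀
  σ : F ≃ₐ[F₀] F
  σ_ne_one : σ ≠ 1

section Lattice

variable {O F₀ F : Type u}
    [CommRing O] [IsDomain O] [IsDiscreteValuationRing O] [Field F₀] [Algebra O F₀]
    [IsFractionRing O F₀] [Field F] [Algebra F₀ F] [Algebra O F] [IsScalarTower O F₀ F]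

/-- The automorphisms of `F` over `F₀` are `1` and `σ`, and `F / F₀` is Galois. -/
theorem isGalois_and (K : RamifiedQuadratic O F₀ F) :
    IsGalois F₀ F ∧ ∀ g : F ≃ₐ[F₀] F, g = 1 ∨ g = K.σ := by
  have : FiniteDimensional F₀ F := Module.finite_of_finrank_eq_succ K.finrank_eq
  classical
  have h1 : Fintype.card (F ≃ₐ[F₀] F) ≤ 2 := by
    rw [← K.finrank_eq]; exact AlgEquiv.card_le
  have h2 : ({1, K.σ} : Finset (F ≃ₐ[F₀] F)).card = 2 :=
    Finset.card_pair K.σ_ne_one.symm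
  have h3 : ({1, K.σ} : Finset (F ≃ₐ[F₀] F)) = Finset.univ := by
    apply Finset.eq_univ_of_card
    have := Finset.card_le_univ ({1, K.σ} : Finset (F ≃ₐ[F₀] F))
    omega
  refine ⟨IsGalois.of_card_aut_eq_finrank F₀ F ?_, fun g => ?_⟩
  · rw [Nat.card_eq_fintype_card, K.finrank_eq, ← h2, h3, Finset.card_univ]
  · have : g ∈ ({1, K.σ} : Finset (F ≃ₐ[F₀] F)) := by rw [h3]; exact Finset.mem_univ g
    simpa using this

theorem trace_eq (K : RamifiedQuadratic O F₀ F) (x : F) :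
    algebraMap F₀ F (Algebra.trace F₀ F x) = x + K.σ x := by
  have : FiniteDimensional F₀ F := Module.finite_of_finrank_eq_succ K.finrank_eq
  obtain ⟨h, hg⟩ := isGalois_and K
  classical
  have h3 : (Finset.univ : Finset (F ≃ₐ[F₀] F)) = {1, K.σ} := by
    ext g; simpa using hg g
  rw [trace_eq_sum_automorphisms]
  have h4 : ∑ g : F ≃ₐ[F₀] F, g x = ∑ g ∈ ({1, K.σ} : Finset (F ≃ₐ[F₀] F)), g x :=
    Finset.sum_congr h3 (fun _ _ => rfl)
  rw [h4, Finset.sum_pair K.σ_ne_one.symm]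
  rfl

theorem π_sq' (K : RamifiedQuadratic O F₀ F) : (K.π : F) ^ 2 = algebraMap O F K.π₀ := by
  have := congrArg (fun a : IntRing O F => (a : F)) K.π_sq
  simpa using this

theorem algebraMap_π₀_ne (K : RamifiedQuadratic O F₀ F) : algebraMap O F₀ K.π₀ ≠ 0 := by
  have := K.irreducible_π₀.ne_zero
  simpa using this

theorem π_ne (K : RamifiedQuadratic O F₀ F) : (K.π : F) ≠ 0 := by
  intro h
  have h1 := π_sq' K
  rw [h, IsScalarTower.algebraMap_apply O F₀ F] at h1
  have h2 : algebraMap F₀ F (algebraMap O F₀ K.π₀) = 0 := by rw [← h1]; ring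
  exact algebraMap_π₀_ne K ((map_eq_zero _).1 h2)

/-- If `z ^ 2 ∈ π₀ O` with `z ∈ F₀`, then `z ∈ π₀ O`. -/
theorem dvd_of_sq (K : RamifiedQuadratic O F₀ F) (z : F₀) (a : O)
    (h : z ^ 2 = algebraMap O F₀ (K.π₀ * a)) : ∃ b : O, z = algebraMap O F₀ (K.π₀ * b) := by
  have hi : IsIntegral O z := by
    refine IsIntegral.of_pow (n := 2) (by norm_num) ?_
    rw [h]; exact isIntegral_algebraMap
  obtain ⟨e, rfl⟩ := IsIntegrallyClosed.isIntegral_iff.1 hi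
  have h2 : e ^ 2 = K.π₀ * a := by
    apply IsFractionRing.injective O F₀
    rw [← h, map_pow]
  have h3 : K.π₀ ∣ e := K.irreducible_π₀.prime.dvd_of_dvd_pow (Dvd.intro _ h2.symm)
  obtain ⟨b, rfl⟩ := h3
  exact ⟨b, rfl⟩

theorem σ_π (K : RamifiedQuadratic O F₀ F) : K.σ (K.π : F) = -(K.π : F) := by
  have : FiniteDimensional F₀ F := Module.finite_of_finrank_eq_succ K.finrank_eq
  obtain ⟨h, hg⟩ := isGalois_and K
  have h1 : K.σ (K.π : F) ^ 2 = (K.π : F) ^ 2 := by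
    rw [← map_pow, π_sq' K, IsScalarTower.algebraMap_apply O F₀ F, AlgEquiv.commutes]
  rcases sq_eq_sq_iff_eq_or_eq_neg.1 h1 with h2 | h2
  · exfalso
    have h3 : ∃ z, algebraMap F₀ F z = (K.π : F) := by
      apply (IsGalois.mem_range_algebraMap_iff_fixed (F := F₀) (E := F) _).2
      intro g
      rcases hg g with rfl | rfl
      · rfl
      · exact h2
    obtain ⟨z, hz⟩ := h3
    have h4 : z ^ 2 = algebraMap O F₀ (K.π₀ * 1) := by
      apply (algebraMap F₀ F).injective
      rw [map_pow, hz, π_sq' K, mul_one, IsScalarTower.algebraMap_apply O F₀ F]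
    obtain ⟨b, hb⟩ := dvd_of_sq K z 1 h4
    have h5 : K.π₀ * (K.π₀ * b ^ 2) = K.π₀ * 1 := by
      apply IsFractionRing.injective O F₀
      rw [← h4, hb, ← map_pow]; congr 1; ring
    have h6 := mul_left_cancel₀ K.irreducible_π₀.ne_zero h5
    exact K.irreducible_π₀.not_isUnit (IsUnit.of_mul_eq_one _ h6)
  · exact h2

theorem σ_integral (K : RamifiedQuadratic O F₀ F) {a : F} (ha : IsIntegral O a) :
    IsIntegral O (K.σ a) :=
  ha.map (K.σ.toAlgHom.restrictScalars O)

/-- `(1/2) Tr` maps `π⁻¹ O_F` into `O_{F₀}`. -/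
theorem half_trace_mem (K : RamifiedQuadratic O F₀ F) {x : F}
    (hx : IsIntegral O ((K.π : F) * x)) :
    ∃ b : O, algebraMap O F₀ b = 2⁻¹ * Algebra.trace F₀ F x := by
  set c := Algebra.trace F₀ F x with hc
  have hcx : (K.π : F) * algebraMap F₀ F c = (K.π : F) * x - K.σ ((K.π : F) * x) := by
    rw [hc, trace_eq K, map_mul, σ_π K]; ring
  have hi : IsIntegral O ((K.π : F) * algebraMap F₀ F c) := by
    rw [hcx]; exact hx.sub (σ_integral K hx)
  have hi2 : IsIntegral O (algebraMap F₀ F (algebraMap O F₀ K.π₀ * c ^ 2)) := by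
    have := hi.pow 2
    rw [mul_pow, π_sq' K, IsScalarTower.algebraMap_apply O F₀ F] at this
    simpa using this
  have hi3 : IsIntegral O (algebraMap O F₀ K.π₀ * c ^ 2) :=
    (isIntegral_algebraMap_iff (algebraMap F₀ F).injective).1 hi2
  obtain ⟨d, hd⟩ := IsIntegrallyClosed.isIntegral_iff.1 hi3
  obtain ⟨b, hb⟩ := dvd_of_sq K (algebraMap O F₀ K.π₀ * c) d (by
    rw [map_mul, hd]; ring)
  have hcb : c = algebraMap O F₀ b := by
    rw [map_mul] at hb
    exact mul_left_cancel₀ (algebraMap_π₀_ne K) hb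
  have h2 : IsUnit (2 : O) := by
    by_contra h
    apply K.residue_two
    have := (IsLocalRing.residue_eq_zero_iff (2 : O)).2 ((IsLocalRing.mem_maximalIdeal _).2 h)
    rwa [map_ofNat] at this
  obtain ⟨v, hv⟩ := h2.exists_right_inv
  refine ⟨v * b, ?_⟩
  have hv' : (2 : F₀) * algebraMap O F₀ v = 1 := by
    rw [← map_one (algebraMap O F₀), ← hv, map_mul, map_ofNat]
  rw [map_mul, ← hcb, eq_inv_of_mul_eq_one_right hv']

variable (K : RamifiedQuadratic O F₀ F) (m : ℕ)

/-- The split hermitian form on `F ^ n`, `n = 2 m`, with `φ (e_i, e_{n+1-j}) = δ_{ij}`. -/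
def herm (x y : Fin (2 * m) → F) : F := ∑ i, x i * K.σ (y (Fin.rev i))

/-- The symmetric form `(x, y) = (1/2) Tr_{F/F₀} φ (x, y)` on `F ^ n`. -/
noncomputable def symForm (x y : Fin (2 * m) → F) : F₀ :=
  2⁻¹ * Algebra.trace F₀ F (herm K m x y)

/-- The vectors `π⁻¹ e_1, …, π⁻¹ e_m, e_{m+1}, …, e_n`. -/
noncomputable def latVec (i : Fin (2 * m)) : Fin (2 * m) → F :=
  if i.val < m then Pi.single i (K.π : F)⁻¹ else Pi.single i 1

/-- The lattice `Λ_m`, the `O_F`-span of `π⁻¹ e_1, …, π⁻¹ e_m, e_{m+1}, …, e_n`. -/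
noncomputable def lattice : Submodule (IntRing O F) (Fin (2 * m) → F) :=
  Submodule.span (IntRing O F) (Set.range (latVec K m))

/-- The vector `latVec i` as an element of `Λ_m`. -/
noncomputable def latBasis (i : Fin (2 * m)) : lattice K m :=
  ⟨latVec K m i, Submodule.subset_span ⟨i, rfl⟩⟩

/-- The `O_{F₀}`-linear endomorphism `t` of `Λ_m`: multiplication by `π`. -/
noncomputable def tMap : lattice K m →ₗ[O] lattice K m :=
  (LinearMap.lsmul (IntRing O F) (lattice K m) K.π).restrictScalars O

/-- Coordinates of elements of `Λ_m`: integral, up to a factor `π⁻¹` in the first half. -/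
theorem lattice_coord {x : Fin (2 * m) → F} (hx : x ∈ lattice K m) (i : Fin (2 * m)) :
    IsIntegral O (if i.val < m then (K.π : F) * x i else x i) := by
  induction hx using Submodule.span_induction with
  | mem x h =>
    obtain ⟨j, rfl⟩ := h
    by_cases hij : i = j
    · subst hij
      by_cases hi : i.val < m
      · simpa [latVec, hi, π_ne K] using isIntegral_one
      · simpa [latVec, hi] using isIntegral_one
    · have h0 : latVec K m j i = 0 := by
        unfold latVec
        split_ifs <;> simp [hij]
      rw [h0]
      simpa using isIntegral_zero
  | zero => simpa using isIntegral_zero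
  | add x y _ _ hx hy =>
    have := hx.add hy
    split_ifs at this ⊢
    · simpa [mul_add] using this
    · simpa using this
  | smul a x _ hx =>
    have := (show IsIntegral O (a : F) from a.2).mul hx
    have e : (a • x) i = (a : F) * x i := rfl
    rw [e]
    split_ifs at this ⊢
    · have e2 : (K.π : F) * ((a : F) * x i) = (a : F) * ((K.π : F) * x i) := by ring
      rw [e2]; exact this
    · exact this

/-- The symmetric form takes values in `O_{F₀}` on `Λ_m`. -/
theorem symForm_integral (x y : lattice K m) :
    ∃ b : O, algebraMap O F₀ b = symForm K m x.1 y.1 := by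
  apply half_trace_mem K
  unfold herm
  rw [Finset.mul_sum]
  refine IsIntegral.sum _ (fun i _ => ?_)
  have h1 := lattice_coord K m x.2 i
  have h2 := σ_integral K (lattice_coord K m y.2 (Fin.rev i))
  have hr : (Fin.rev i).val < m ↔ ¬ i.val < m := by
    rw [Fin.val_rev]; omega
  by_cases hi : i.val < m
  · rw [if_neg (fun h => hr.1 h hi)] at h2
    rw [if_pos hi] at h1
    rw [← mul_assoc]
    exact h1.mul h2
  · rw [if_pos (hr.2 hi), map_mul, σ_π K] at h2
    rw [if_neg hi] at h1
    have := (h1.mul h2).neg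
    have e : (K.π : F) * (x.1 i * K.σ (y.1 (Fin.rev i)))
      = -(x.1 i * (-(K.π : F) * K.σ (y.1 (Fin.rev i)))) := by ring
    rw [e]; exact this

theorem symForm_add_left (x y z : Fin (2 * m) → F) :
    symForm K m (x + y) z = symForm K m x z + symForm K m y z := by
  simp only [symForm, herm, Pi.add_apply, add_mul, Finset.sum_add_distrib, map_add, mul_add]

theorem symForm_add_right (x y z : Fin (2 * m) → F) :
    symForm K m x (y + z) = symForm K m x y + symForm K m x z := by
  simp only [symForm, herm, Pi.add_apply, mul_add, map_add, Finset.sum_add_distrib]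

theorem symForm_smul_left (a : O) (x y : Fin (2 * m) → F) :
    symForm K m (a • x) y = algebraMap O F₀ a * symForm K m x y := by
  have : herm K m (a • x) y = algebraMap O F₀ a • herm K m x y := by
    simp only [herm, Pi.smul_apply, Finset.smul_sum, algebraMap_smul, smul_mul_assoc]
  simp only [symForm, this, map_smul, smul_eq_mul]
  ring

theorem symForm_smul_right (a : O) (x y : Fin (2 * m) → F) :
    symForm K m x (a • y) = algebraMap O F₀ a * symForm K m x y := by
  have : herm K m x (a • y) = algebraMap O F₀ a • herm K m x y := by
    simp only [herm, Pi.smul_apply, Finset.smul_sum]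
    refine Finset.sum_congr rfl (fun i _ => ?_)
    rw [← algebraMap_smul F₀ a (y (Fin.rev i)), map_smul, mul_smul_comm]
  simp only [symForm, this, map_smul, smul_eq_mul]
  ring

/-- The symmetric pairing `( , ) : Λ_m × Λ_m → O_{F₀}`, the restriction of `symForm`. -/
noncomputable def latForm : LinearMap.BilinForm O (lattice K m) :=
  LinearMap.mk₂ O (fun x y => (symForm_integral K m x y).choose)
    (fun x y z => by
      apply IsFractionRing.injective O F₀
      rw [map_add, (symForm_integral K m (x + y) z).choose_spec,
        (symForm_integral K m x z).choose_spec, (symForm_integral K m y z).choose_spec]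
      exact symForm_add_left K m _ _ _)
    (fun a x y => by
      apply IsFractionRing.injective O F₀
      rw [smul_eq_mul, map_mul, (symForm_integral K m (a • x) y).choose_spec,
        (symForm_integral K m x y).choose_spec]
      exact symForm_smul_left K m _ _ _)
    (fun x y z => by
      apply IsFractionRing.injective O F₀
      rw [map_add, (symForm_integral K m x (y + z)).choose_spec,
        (symForm_integral K m x y).choose_spec, (symForm_integral K m x z).choose_spec]
      exact symForm_add_right K m _ _ _)
    (fun a x y => by
      apply IsFractionRing.injective O F₀
      rw [smul_eq_mul, map_mul, (symForm_integral K m x (a • y)).choose_spec,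
        (symForm_integral K m x y).choose_spec]
      exact symForm_smul_right K m _ _ _)

theorem algebraMap_latForm (x y : lattice K m) :
    algebraMap O F₀ (latForm K m x y) = symForm K m x.1 y.1 :=
  (symForm_integral K m x y).choose_spec

end Lattice

section Moduli

variable {O F₀ F : Type u}
    [CommRing O] [IsDomain O] [IsDiscreteValuationRing O] [Field F₀] [Algebra O F₀]
    [IsFractionRing O F₀] [Field F] [Algebra F₀ F] [Algebra O F] [IsScalarTower O F₀ F]
    (K : RamifiedQuadratic O F₀ F) (m s : ℕ)

/-- `Λ_m ⊗_{O_{F₀}} B`. -/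
abbrev LatticeOver (B : Type u) [CommRing B] [Algebra O B] : Type u :=
  B ⊗[O] lattice K m

/-- The operator `t ⊗ 1` on `Λ_m ⊗ B`. -/
noncomputable def tOver (B : Type u) [CommRing B] [Algebra O B] :
    LatticeOver K m B →ₗ[B] LatticeOver K m B :=
  (tMap K m).baseChange B

/-- The points of the naive splitting model with values in (the spectrum of) an `O_F`-algebra `B`:
pairs of direct summands `F_0 ⊂ F_1` of `Λ_m ⊗ B`, of constant ranks `s` and `n = 2 m`, with
`F_1 = F_1^⊥`, `(t + π) F_1 ⊂ F_0` and `(t - π) F_0 = 0`. -/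
structure SplittingPair (B : Type u) [CommRing B] [Algebra O B] [Algebra (IntRing O F) B]
    [IsScalarTower O (IntRing O F) B] where
  F0 : Submodule B (LatticeOver K m B)
  F1 : Submodule B (LatticeOver K m B)
  summand_F0 : ∃ G, IsCompl F0 G
  summand_F1 : ∃ G, IsCompl F1 G
  rank_F0 : ∀ p : PrimeSpectrum B, Module.rankAtStalk F0 p = s
  rank_F1 : ∀ p : PrimeSpectrum B, Module.rankAtStalk F1 p = 2 * m
  le : F0 ≤ F1
  perp : ((latForm K m).baseChange B).orthogonal F1 = F1
  t_add_mem : ∀ x ∈ F1, tOver K m B x + algebraMap (IntRing O F) B K.π • x ∈ F0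
  t_sub_eq_zero : ∀ x ∈ F0, tOver K m B x - algebraMap (IntRing O F) B K.π • x = 0

/-- The base change of a submodule of `Λ_m ⊗ B` along `f : B → C`: the `C`-span of its image in
`Λ_m ⊗ C`. (For a direct summand `N` this is `N ⊗_B C`.) -/
noncomputable def extend {B C : Type u} [CommRing B] [Algebra O B] [CommRing C] [Algebra O C]
    (f : B →ₐ[O] C) (N : Submodule B (LatticeOver K m B)) : Submodule C (LatticeOver K m C) :=
  Submodule.span C
    (TensorProduct.map f.toLinearMap (LinearMap.id : lattice K m →ₗ[O] lattice K m) ''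
      (N : Set (LatticeOver K m B)))

end Moduli

/-! ### The moduli problem on schemes over `Spec O_F` -/

section Schemes

/-- `Spec O_F`. -/
noncomputable abbrev Base (O F : Type u) [CommRing O] [Field F] [Algebra O F] : Scheme.{u} :=
  Spec (CommRingCat.of (IntRing O F))

section Sections

variable {O F : Type u} [CommRing O] [Field F] [Algebra O F]

/-- The ring `Γ(S, U)` of sections, for `S` a scheme over `Spec O_F`. -/
def Sec (S : Over (Base O F)) (U : S.left.Opens) : Type u := Γ(S.left, U)

noncomputable instance (S : Over (Base O F)) (U : S.left.Opens) : CommRing (Sec S U) :=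
  inferInstanceAs (CommRing Γ(S.left, U))

/-- The structure morphism `S ⟶ Spec O_F`. -/
noncomputable abbrev str (S : Over (Base O F)) : S.left ⟶ Base O F := S.hom

theorem le_preimage_top (S : Over (Base O F)) (U : S.left.Opens) : U ≤ (str S) ⁻¹ᵁ ⊤ :=
  fun _ _ => trivial

/-- The structure map `O_F → Γ(S, U)`. -/
noncomputable def secStr (S : Over (Base O F)) (U : S.left.Opens) :
    CommRingCat.of (IntRing O F) ⟶ Γ(S.left, U) :=
  (Scheme.ΓSpecIso (CommRingCat.of (IntRing O F))).inv ≫ (str S).appLE ⊤ U (le_preimage_top S U)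

noncomputable instance (S : Over (Base O F)) (U : S.left.Opens) :
    Algebra (IntRing O F) (Sec S U) :=
  RingHom.toAlgebra (secStr S U).hom

noncomputable instance (S : Over (Base O F)) (U : S.left.Opens) : Algebra O (Sec S U) :=
  RingHom.toAlgebra ((algebraMap (IntRing O F) (Sec S U)).comp (algebraMap O (IntRing O F)))

instance (S : Over (Base O F)) (U : S.left.Opens) : IsScalarTower O (IntRing O F) (Sec S U) :=
  IsScalarTower.of_algebraMap_eq (fun _ => rfl)

/-- The map `Γ(S, U) → Γ(T, V)` attached to `g : T ⟶ S` over `Spec O_F`, where `g V ⊆ U`. -/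
noncomputable def secMap {S T : Over (Base O F)} (g : T ⟶ S) (U : S.left.Opens) (V : T.left.Opens)
    (h : V ≤ g.left ⁻¹ᵁ U) : Sec S U →ₐ[O] Sec T V :=
  AlgHom.restrictScalars O
    ({ (g.left.appLE U V h).hom with
        commutes' := fun a => by
          have e : secStr S U ≫ g.left.appLE U V h = secStr T V := by
            have w : g.left ≫ str S = str T := Over.w g
            unfold secStr
            rw [Category.assoc, Scheme.Hom.appLE_comp_appLE]
            simp only [w]
          exact congrArg (fun f => f.hom a) e } : Sec S U →ₐ[IntRing O F] Sec T V)

end Sections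

variable {O F₀ F : Type u}
    [CommRing O] [IsDomain O] [IsDiscreteValuationRing O] [Field F₀] [Algebra O F₀]
    [IsFractionRing O F₀] [Field F] [Algebra F₀ F] [Algebra O F] [IsScalarTower O F₀ F]
    (K : RamifiedQuadratic O F₀ F) (m s : ℕ)

/-- The set `𝓜(S)` of points of the naive splitting model with values in a scheme `S` over
`Spec O_F`: pairs of locally direct summands `F_0 ⊂ F_1` of `Λ_m ⊗ 𝒪_S` with the required
properties. A (quasi-coherent) locally direct summand is given by its sections over the affine
opens, which are direct summands compatible with restriction. -/
structure SplittingFamily (S : Over (Base O F)) where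
  pt : ∀ U : S.left.affineOpens, SplittingPair K m s (Sec S U.1)
  F0_res : ∀ (U V : S.left.affineOpens) (h : V.1 ≤ (𝟙 S : S ⟶ S).left ⁻¹ᵁ U.1),
    (pt V).F0 = extend K m (secMap (𝟙 S) U.1 V.1 h) (pt U).F0
  F1_res : ∀ (U V : S.left.affineOpens) (h : V.1 ≤ (𝟙 S : S ⟶ S).left ⁻¹ᵁ U.1),
    (pt V).F1 = extend K m (secMap (𝟙 S) U.1 V.1 h) (pt U).F1

variable {K m s}

/-- `x = g^* y` in `𝓜(T)`, for `g : T ⟶ S` and `y ∈ 𝓜(S)`. -/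
def IsPullbackOf {S T : Over (Base O F)} (g : T ⟶ S) (y : SplittingFamily K m s S)
    (x : SplittingFamily K m s T) : Prop :=
  ∀ (U : S.left.affineOpens) (V : T.left.affineOpens) (h : V.1 ≤ g.left ⁻¹ᵁ U.1),
    (x.pt V).F0 = extend K m (secMap g U.1 V.1 h) (y.pt U).F0 ∧
    (x.pt V).F1 = extend K m (secMap g U.1 V.1 h) (y.pt U).F1

/-- The scheme `M` over `Spec O_F` with `ξ ∈ 𝓜(M)` is the naive splitting model: it represents the
functor `𝓜`, with universal point `ξ`. -/
def IsNaiveSplittingModel (M : Over (Base O F)) (ξ : SplittingFamily K m s M) : Prop :=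
  ∀ (T : Over (Base O F)) (x : SplittingFamily K m s T), ∃! g : T ⟶ M, IsPullbackOf g ξ x

/-- The point `x = (F_0, F_1)` has `F_1 = t Λ_m`. -/
def IsTLattice {T : Over (Base O F)} (x : SplittingFamily K m s T) : Prop :=
  ∀ U : T.left.affineOpens, (x.pt U).F1 = LinearMap.range (tOver K m (Sec T U.1))

variable (K m) in
/-- The span of `b_1, …, b_n` in `Λ_m ⊗ B`, where `b_i` is `π⁻¹ e_i` for `i ≤ m` and `e_i` for
`i > m`; together with `t b_1, …, t b_n` these form a basis of `Λ_m ⊗ B`. -/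
noncomputable def upperSpan (B : Type u) [CommRing B] [Algebra O B] :
    Submodule B (LatticeOver K m B) :=
  Submodule.span B (Set.range (fun j => (1 : B) ⊗ₜ[O] latBasis K m j))

variable (K m) in
/-- The span of `b_1, …, b_n` and of the `t b_j` with `j` not among `i_1, …, i_s`. -/
noncomputable def minorSpan (i : Fin s ↪ Fin (2 * m)) (B : Type u) [CommRing B] [Algebra O B] :
    Submodule B (LatticeOver K m B) :=
  upperSpan K m B ⊔
    Submodule.span B ((fun j => (1 : B) ⊗ₜ[O] tMap K m (latBasis K m j)) '' (Set.range i)ᶜ)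

/-- The open condition cutting out the chart for the rows `i_1, …, i_s`. In the basis
`b_1, …, b_n, t b_1, …, t b_n`, the submodule `F_1` is spanned by the columns of a block matrix with
lower block `I_n` (it is a complement of the span of the `b_j`), and the `s × s` minor of `F_0` in
the rows of `t b_{i_1}, …, t b_{i_s}` is invertible (`F_0` is a complement of the span of the
other basis vectors). -/
def InChart (i : Fin s ↪ Fin (2 * m)) {T : Over (Base O F)} (x : SplittingFamily K m s T) : Prop :=
  ∀ U : T.left.affineOpens,
    IsCompl (x.pt U).F1 (upperSpan K m (Sec T U.1)) ∧
    IsCompl (x.pt U).F0 (minorSpan K m i (Sec T U.1))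

end Schemes

/-! ### The equations of the chart -/

section Chart

variable {A : Type u} [CommRing A]

/-- The polynomial ring `A[D, Y]`, with `D` of size `s × s` and `Y` of size `n × s`, `n = 2 m`. -/
abbrev PolyDY (A : Type u) [CommRing A] (m s : ℕ) : Type u :=
  MvPolynomial ((Fin s × Fin s) ⊕ (Fin (2 * m) × Fin s)) A

/-- The generic matrix `D`. -/
noncomputable def matD (A : Type u) [CommRing A] (m s : ℕ) :
    Matrix (Fin s) (Fin s) (PolyDY A m s) :=
  Matrix.of fun p q => MvPolynomial.X (Sum.inl (p, q))

/-- The generic matrix `Y`. -/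
noncomputable def matY (A : Type u) [CommRing A] (m s : ℕ) :
    Matrix (Fin (2 * m)) (Fin s) (PolyDY A m s) :=
  Matrix.of fun p q => MvPolynomial.X (Sum.inr (p, q))

/-- The matrix `Ỹ` with rows `y_n, …, y_{m+1}, -y_m, …, -y_1`, where `y_j` are the rows of `Y`. -/
noncomputable def yTilde {R : Type u} [CommRing R] {m s : ℕ}
    (Y : Matrix (Fin (2 * m)) (Fin s) R) : Matrix (Fin (2 * m)) (Fin s) R :=
  Matrix.of fun p q => if p.val < m then Y (Fin.rev p) q else -Y (Fin.rev p) q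

/-- The set of entries of a matrix. -/
def entries {R : Type u} {a b : ℕ} (M : Matrix (Fin a) (Fin b) R) : Set R :=
  {c | ∃ p q, c = M p q}

/-- The ideal `I = (Y' - I_s, D + Dᵗ, D Q + 2 ϖ I_s)` of `A[D, Y]`, where `Q = Ỹᵗ Y`, and `Y'`
consists of the rows `i_1, …, i_s` of `Y`. -/
noncomputable def chartIdeal (ϖ : A) {m s : ℕ} (i : Fin s ↪ Fin (2 * m)) :
    Ideal (PolyDY A m s) :=
  Ideal.span
    (entries ((matY A m s).submatrix i id - 1) ∪
     entries (matD A m s + (matD A m s).transpose) ∪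
     entries (matD A m s * ((yTilde (matY A m s)).transpose * matY A m s) +
       (2 * MvPolynomial.C ϖ : PolyDY A m s) • (1 : Matrix (Fin s) (Fin s) (PolyDY A m s))))

/-- The ring `A[D, Y] / I`. -/
abbrev ChartRing (ϖ : A) {m s : ℕ} (i : Fin s ↪ Fin (2 * m)) : Type u :=
  PolyDY A m s ⧸ chartIdeal ϖ i

end Chart

/-- The scheme `Spec O_F[D, Y] / I` over `Spec O_F`. -/
noncomputable def chartScheme {O F : Type u} [CommRing O] [Field F] [Algebra O F]
    (ϖ : IntRing O F) {m s : ℕ} (i : Fin s ↪ Fin (2 * m)) : Over (Base O F) :=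
  Over.mk (Spec.map (CommRingCat.ofHom (algebraMap (IntRing O F) (ChartRing ϖ i))))

/-- The scheme `Spec κ` over `Spec O_F` attached to a homomorphism from `O_F` to a field `κ`. -/
noncomputable def specField {O F : Type u} [CommRing O] [Field F] [Algebra O F]
    {κ : Type u} [Field κ] (f : IntRing O F →+* κ) : Over (Base O F) :=
  Over.mk (Spec.map (CommRingCat.ofHom f))

end NaiveSplitting

open NaiveSplitting

/-!
The proof is linear algebra in coordinates over a ring `B`, followed by gluing.

Write an element of `Λ_m ⊗ B` as `(u, v)`, for `∑ u_j b_j + ∑ v_j t b_j` with `u, v ∈ B ^ n`. Then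
`t (u, v) = (π₀ v, u)`, and the symmetric form is `((u, v), (u', v')) = J u · v' + v · J u'` with a
skew matrix `J` such that `J² = -1` and `J Y = Ỹ` (`form_ofCoords`). A complement of the span of the
`b_j` is a graph `F_1 = {(X v, v)}`. As `t - π` kills `F_0`, a complement `F_0` of the span of the
`b_j` and the `t b_j` with `j` not among `i_1, …, i_s` is `{(π Y a, Y a)}` for a unique `Y` with
`Y' = 1`. The remaining conditions become:

* `F_1 = F_1^⊥` if and only if `J X` is skew;
* `F_0 ⊂ F_1` if and only if `X Y = π Y`;
* `(t + π) F_1 ⊂ F_0` if and only if `X + π = Y Z` for some `Z`.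

Given the first and the third, `Ỹ Z = J X + π J` is skew, and since `Ỹ` has a left inverse this
forces `Z = -D Ỹᵗ` with a unique skew `D`; the second condition then reads `D Q + 2 π = 0`. So the
points of the chart over `B` are the solutions `(D, Y)` of the equations of the chart ring, with
`X = -Y D Ỹᵗ - π` (`exists_isChartDatum`, `chartPair`, `IsChartDatum.ext`).

The chart condition at a prime `q` says that some `n × n` minor of elements of `F_1` and some
`s × s` minor of elements of `F_0` are not in `q` (`isCompl_minorSpan_iff`, which uses that the
ranks are constant). This is compatible with base change (`minorAt_extend_iff`) and visibly open, so
the condition defines an open locus (`isOpen_chartLocus`) whose formation commutes with pullback.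

Over a scheme, the data over the affine opens glue because they are unique, which gives
representability (`existsUnique_hom_of_inChart`). If a scheme `M` represents the whole functor, then
the morphism from the chart to `M` given by the universal point and the morphism from the chart
locus of `M` to the chart are mutually inverse (`isOpenImmersion_of_isPullbackOf`). Pullbacks can be
compared and composed because direct summands that agree locally are equal (`eq_of_locally`).

Over a field, the projection of `F_0` to the `v`-coordinates is injective, so an `s × s` minor is
invertible, and an isotropic `t Λ_m` forces `π₀ = 0`, which makes it the span of the `t b_j`
(`exists_inChart_of_isTLattice`). If `π = 0`, the solution with `D = 0` has `F_1 = t Λ_m`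
(`exists_isTLattice_inChart`).
-/

namespace NaiveSplitting

/-! ### The basis of the lattice -/

section LatticeBasis

variable {O F₀ F : Type u}
    [CommRing O] [IsDomain O] [IsDiscreteValuationRing O] [Field F₀] [Algebra O F₀]
    [IsFractionRing O F₀] [Field F] [Algebra F₀ F] [Algebra O F] [IsScalarTower O F₀ F]

theorem isUnit_two (K : RamifiedQuadratic O F₀ F) : IsUnit (2 : O) := by
  by_contra h
  apply K.residue_two
  have := (IsLocalRing.residue_eq_zero_iff (2 : O)).2 ((IsLocalRing.mem_maximalIdeal _).2 h)
  rwa [map_ofNat] at this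

theorem two_ne_zero_base (K : RamifiedQuadratic O F₀ F) : (2 : F₀) ≠ 0 := by
  have h := (isUnit_two K).map (algebraMap O F₀)
  rw [map_ofNat] at h
  exact h.ne_zero

theorem two_ne_zero_ext (K : RamifiedQuadratic O F₀ F) : (2 : F) ≠ 0 := by
  have h := (map_ne_zero (algebraMap F₀ F)).2 (two_ne_zero_base K)
  rwa [map_ofNat] at h

theorem algebraMap_half_trace (K : RamifiedQuadratic O F₀ F) (x : F) :
    algebraMap F₀ F (2⁻¹ * Algebra.trace F₀ F x) = 2⁻¹ * (x + K.σ x) := by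
  rw [map_mul, trace_eq K, map_inv₀, map_ofNat]

theorem σ_algebraMap (K : RamifiedQuadratic O F₀ F) (x : O) :
    K.σ (algebraMap O F x) = algebraMap O F x := by
  rw [IsScalarTower.algebraMap_apply O F₀ F, AlgEquiv.commutes]

theorem σ_π_inv (K : RamifiedQuadratic O F₀ F) : K.σ (K.π : F)⁻¹ = -(K.π : F)⁻¹ := by
  rw [map_inv₀, σ_π K, inv_neg]

/-- `O_F = O ⊕ O π`: since `2` is invertible, the two components of `a` are half the traces of
`a` and of `π⁻¹ a`, which are integral by `half_trace_mem`. -/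
theorem exists_add_mul_π (K : RamifiedQuadratic O F₀ F) (a : IntRing O F) :
    ∃ x y : O, a = algebraMap O (IntRing O F) x + algebraMap O (IntRing O F) y * K.π := by
  have ha : IsIntegral O (a : F) := a.2
  have h2 := two_ne_zero_ext K
  have hπ := π_ne K
  obtain ⟨x, hx⟩ := half_trace_mem K (x := (a : F)) (K.π.2.mul ha)
  obtain ⟨y, hy⟩ := half_trace_mem K (x := (K.π : F)⁻¹ * a) (by
    rw [mul_inv_cancel_left₀ hπ]; exact ha)
  have hx' := congrArg (algebraMap F₀ F) hx
  have hy' := congrArg (algebraMap F₀ F) hy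
  rw [algebraMap_half_trace K, ← IsScalarTower.algebraMap_apply] at hx' hy'
  rw [map_mul, σ_π_inv K] at hy'
  refine ⟨x, y, Subtype.ext ?_⟩
  change (a : F) = algebraMap O F x + algebraMap O F y * K.π
  rw [hx', hy']
  field_simp
  ring

theorem add_mul_π_eq_zero (K : RamifiedQuadratic O F₀ F) {x y : O}
    (h : algebraMap O F x + algebraMap O F y * K.π = 0) : x = 0 ∧ y = 0 := by
  have hinj : Function.Injective (algebraMap O F) := by
    rw [IsScalarTower.algebraMap_eq O F₀ F]
    exact (algebraMap F₀ F).injective.comp (IsFractionRing.injective O F₀)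
  have h' := congrArg K.σ h
  rw [map_add, map_mul, σ_algebraMap K, σ_algebraMap K, σ_π K, map_zero] at h'
  have h1 : 2 * algebraMap O F x = 0 := by linear_combination h + h'
  have h2 : algebraMap O F x = 0 := (mul_eq_zero.1 h1).resolve_left (two_ne_zero_ext K)
  rw [h2, zero_add] at h
  have h3 := (mul_eq_zero.1 h).resolve_right (π_ne K)
  exact ⟨hinj (by rw [h2, map_zero]), hinj (by rw [h3, map_zero])⟩

variable (K : RamifiedQuadratic O F₀ F) (m : ℕ)

/-- The scalar `c` with `b_i = c e_i`. -/
noncomputable def latScale (i : Fin (2 * m)) : F := if i.val < m then (K.π : F)⁻¹ else 1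

theorem latScale_ne_zero (i : Fin (2 * m)) : latScale K m i ≠ 0 := by
  unfold latScale
  split_ifs
  · exact inv_ne_zero (π_ne K)
  · exact one_ne_zero

theorem latVec_eq (i : Fin (2 * m)) : latVec K m i = Pi.single i (latScale K m i) := by
  unfold latVec latScale
  split_ifs <;> rfl

theorem coe_latBasis (i : Fin (2 * m)) :
    (latBasis K m i : Fin (2 * m) → F) = Pi.single i (latScale K m i) := latVec_eq K m i

theorem coe_tMap (x : lattice K m) :
    (tMap K m x : Fin (2 * m) → F) = (K.π : F) • (x : Fin (2 * m) → F) := rfl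

theorem tMap_tMap (x : lattice K m) : tMap K m (tMap K m x) = K.π₀ • x := by
  apply Subtype.ext
  rw [coe_tMap, coe_tMap, smul_smul, ← sq, π_sq' K]
  exact algebraMap_smul F K.π₀ (x : Fin (2 * m) → F)

/-- The family `b_1, …, b_n, t b_1, …, t b_n`; the left summand indexes the `b_j`, the right one
the `t b_j`. -/
noncomputable def latFamily : Fin (2 * m) ⊕ Fin (2 * m) → lattice K m :=
  Sum.elim (latBasis K m) (fun j => tMap K m (latBasis K m j))

theorem linearIndependent_latFamily : LinearIndependent O (latFamily K m) := by
  rw [Fintype.linearIndependent_iff]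
  intro g hg
  have key : ∀ i, g (Sum.inl i) = 0 ∧ g (Sum.inr i) = 0 := by
    intro i
    have h1 := congrArg (fun x : lattice K m => (x : Fin (2 * m) → F) i) hg
    simp only [Fintype.sum_sum_type, latFamily, Sum.elim_inl, Sum.elim_inr] at h1
    have h2 : ∀ (c : Fin (2 * m) → O) (f : Fin (2 * m) → lattice K m),
        ((∑ j, c j • f j : lattice K m) : Fin (2 * m) → F) i =
          ∑ j, algebraMap O F (c j) * (f j : Fin (2 * m) → F) i := by
      intro c f
      rw [AddSubmonoidClass.coe_finsetSum, Finset.sum_apply]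
      refine Finset.sum_congr rfl fun j _ => ?_
      exact Algebra.smul_def (c j) ((f j : Fin (2 * m) → F) i)
    have h3 : ∀ x y : lattice K m, ((x + y : lattice K m) : Fin (2 * m) → F) i =
      (x : Fin (2 * m) → F) i + (y : Fin (2 * m) → F) i := fun _ _ => rfl
    rw [h3, h2, h2] at h1
    simp only [coe_tMap, coe_latBasis, Pi.smul_apply, Pi.single_apply, smul_eq_mul, mul_ite,
      mul_zero, Finset.sum_ite_eq, Finset.mem_univ, if_true] at h1
    have h4 : (algebraMap O F (g (Sum.inl i)) + algebraMap O F (g (Sum.inr i)) * K.π) *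
        latScale K m i = 0 := by
      refine Eq.trans ?_ h1
      ring
    exact add_mul_π_eq_zero K ((mul_eq_zero.1 h4).resolve_right (latScale_ne_zero K m i))
  rintro (i | i)
  exacts [(key i).1, (key i).2]

theorem span_latFamily : ⊤ ≤ Submodule.span O (Set.range (latFamily K m)) := by
  have hb : ∀ j, latBasis K m j ∈ Submodule.span O (Set.range (latFamily K m)) :=
    fun j => Submodule.subset_span ⟨Sum.inl j, rfl⟩
  have ht : ∀ j, tMap K m (latBasis K m j) ∈ Submodule.span O (Set.range (latFamily K m)) :=
    fun j => Submodule.subset_span ⟨Sum.inr j, rfl⟩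
  have hπ : ∀ x ∈ Submodule.span O (Set.range (latFamily K m)),
      tMap K m x ∈ Submodule.span O (Set.range (latFamily K m)) := by
    intro x hx
    induction hx using Submodule.span_induction with
    | mem x h =>
      obtain ⟨j | j, rfl⟩ := h
      · exact ht j
      · change tMap K m (tMap K m (latBasis K m j)) ∈ _
        rw [tMap_tMap]
        exact Submodule.smul_mem _ _ (hb j)
    | zero => rw [map_zero]; exact Submodule.zero_mem _
    | add x y _ _ hx hy => rw [map_add]; exact Submodule.add_mem _ hx hy
    | smul a x _ hx => rw [map_smul]; exact Submodule.smul_mem _ _ hx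
  rintro ⟨x, hx⟩ -
  induction hx using Submodule.span_induction with
  | mem x h => obtain ⟨j, rfl⟩ := h; exact hb j
  | zero => exact Submodule.zero_mem _
  | add x y hx hy h1 h2 => exact Submodule.add_mem _ h1 h2
  | smul a x hx h =>
    obtain ⟨p, q, rfl⟩ := exists_add_mul_π K a
    have e : (⟨(algebraMap O (IntRing O F) p + algebraMap O (IntRing O F) q * K.π) • x,
        Submodule.smul_mem _ _ hx⟩ : lattice K m) = p • ⟨x, hx⟩ + q • tMap K m ⟨x, hx⟩ := by
      apply Subtype.ext
      change (algebraMap O (IntRing O F) p + algebraMap O (IntRing O F) q * K.π) • x =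
        p • x + q • ((K.π : IntRing O F) • x)
      rw [add_smul, mul_smul, algebraMap_smul, algebraMap_smul]
    rw [e]
    exact Submodule.add_mem _ (Submodule.smul_mem _ _ h) (Submodule.smul_mem _ _ (hπ _ h))

/-- The `O`-basis `b_1, …, b_n, t b_1, …, t b_n` of `Λ_m`. -/
noncomputable def latticeBasis : Module.Basis (Fin (2 * m) ⊕ Fin (2 * m)) O (lattice K m) :=
  Module.Basis.mk (linearIndependent_latFamily K m) (span_latFamily K m)

theorem latticeBasis_inl (j : Fin (2 * m)) : latticeBasis K m (Sum.inl j) = latBasis K m j := by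
  simp [latticeBasis, latFamily]

theorem latticeBasis_inr (j : Fin (2 * m)) :
    latticeBasis K m (Sum.inr j) = tMap K m (latBasis K m j) := by
  simp [latticeBasis, latFamily]

/-! ### The symmetric form in the basis -/

/-- The sign of the pairing of `b_i` with `t b_{n+1-i}`: it is `-1` for `i ≤ m` and `1` for
`i > m`. -/
def rowSign (R : Type u) [CommRing R] {m : ℕ} (i : Fin (2 * m)) : R := if i.val < m then -1 else 1

theorem rev_lt_iff {m : ℕ} (i : Fin (2 * m)) : (Fin.rev i).val < m ↔ ¬ i.val < m := by
  rw [Fin.val_rev]; omega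

theorem rowSign_rev {R : Type u} [CommRing R] {m : ℕ} (i : Fin (2 * m)) :
    rowSign R (Fin.rev i) = -rowSign R i := by
  unfold rowSign
  by_cases h : i.val < m
  · rw [if_neg (fun h' => (rev_lt_iff i).1 h' h), if_pos h, neg_neg]
  · rw [if_pos ((rev_lt_iff i).2 h), if_neg h]

theorem rowSign_mul_self {R : Type u} [CommRing R] {m : ℕ} (i : Fin (2 * m)) :
    rowSign R i * rowSign R i = 1 := by
  unfold rowSign; split_ifs <;> ring

theorem map_rowSign {R R' : Type u} [CommRing R] [CommRing R'] (f : R →+* R') {m : ℕ}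
    (i : Fin (2 * m)) : f (rowSign R i) = rowSign R' i := by
  unfold rowSign; split_ifs <;> simp

theorem latScale_mul (i : Fin (2 * m)) :
    latScale K m i * K.σ (latScale K m (Fin.rev i)) = -rowSign F i * (K.π : F)⁻¹ := by
  unfold latScale rowSign
  by_cases h : i.val < m
  · rw [if_neg (fun h' => (rev_lt_iff i).1 h' h), if_pos h, if_pos h, map_one]; ring
  · rw [if_pos ((rev_lt_iff i).2 h), if_neg h, if_neg h, σ_π_inv K]; ring

theorem herm_latBasis (i j : Fin (2 * m)) :
    herm K m (latBasis K m i) (latBasis K m j) =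
      if j = Fin.rev i then -rowSign F i * (K.π : F)⁻¹ else 0 := by
  unfold herm
  rw [Finset.sum_eq_single i]
  · rw [coe_latBasis, coe_latBasis, Pi.single_eq_same]
    split_ifs with h
    · rw [h, Pi.single_eq_same, latScale_mul]
    · rw [Pi.single_eq_of_ne (Ne.symm h), map_zero, mul_zero]
  · intro k _ hk
    rw [coe_latBasis, Pi.single_eq_of_ne hk, zero_mul]
  · simp

theorem herm_smul_left (a : F) (x y : Fin (2 * m) → F) :
    herm K m (a • x) y = a * herm K m x y := by
  simp only [herm, Pi.smul_apply, smul_eq_mul, Finset.mul_sum, mul_assoc]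

theorem herm_smul_right (a : F) (x y : Fin (2 * m) → F) :
    herm K m x (a • y) = K.σ a * herm K m x y := by
  simp only [herm, Pi.smul_apply, smul_eq_mul, Finset.mul_sum, map_mul]
  exact Finset.sum_congr rfl fun _ _ => by ring

/-- If the trace of `φ (x, y)`, computed in `F`, is `2 c`, then `(x, y) = c`. -/
theorem latForm_eq_of_trace (x y : lattice K m) (c : O) (h : herm K m x y + K.σ (herm K m x y) =
    2 * algebraMap O F c) : latForm K m x y = c := by
  apply IsFractionRing.injective O F₀
  apply (algebraMap F₀ F).injective
  rw [algebraMap_latForm, symForm, algebraMap_half_trace K, h, ← IsScalarTower.algebraMap_apply,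
    inv_mul_cancel_left₀ (two_ne_zero_ext K)]

theorem σ_rowSign (i : Fin (2 * m)) : K.σ (rowSign F i) = rowSign F i :=
  map_rowSign (K.σ : F →+* F) i

theorem latForm_basis_basis (i j : Fin (2 * m)) :
    latForm K m (latBasis K m i) (latBasis K m j) = 0 := by
  apply latForm_eq_of_trace
  rw [herm_latBasis]
  split_ifs
  · rw [map_mul, map_neg, σ_rowSign K, σ_π_inv K, map_zero]; ring
  · simp

theorem latForm_basis_t (i j : Fin (2 * m)) :
    latForm K m (latBasis K m i) (tMap K m (latBasis K m j)) =
      if j = Fin.rev i then rowSign O i else 0 := by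
  apply latForm_eq_of_trace
  rw [coe_tMap, herm_smul_right, herm_latBasis, σ_π K]
  have hπ := π_ne K
  split_ifs
  · have e : -(K.π : F) * (-rowSign F i * (K.π : F)⁻¹) = rowSign F i := by field_simp
    rw [e, σ_rowSign K, map_rowSign]; ring
  · simp

theorem latForm_t_basis (i j : Fin (2 * m)) :
    latForm K m (tMap K m (latBasis K m i)) (latBasis K m j) =
      if j = Fin.rev i then -rowSign O i else 0 := by
  apply latForm_eq_of_trace
  rw [coe_tMap, herm_smul_left, herm_latBasis]
  have hπ := π_ne K
  split_ifs
  · have e : (K.π : F) * (-rowSign F i * (K.π : F)⁻¹) = -rowSign F i := by field_simp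
    rw [e, map_neg, map_neg, σ_rowSign K, map_rowSign]; ring
  · simp

theorem latForm_t_t (i j : Fin (2 * m)) :
    latForm K m (tMap K m (latBasis K m i)) (tMap K m (latBasis K m j)) = 0 := by
  apply latForm_eq_of_trace
  rw [coe_tMap, coe_tMap, herm_smul_left, herm_smul_right, herm_latBasis]
  split_ifs
  · simp only [map_mul, map_neg, σ_rowSign K, σ_π_inv K, map_zero, σ_π K]; ring
  · simp

end LatticeBasis

/-! ### Coordinates and base change of submodules -/

section Coordinates

variable {O F₀ F : Type u}
    [CommRing O] [IsDomain O] [IsDiscreteValuationRing O] [Field F₀] [Algebra O F₀]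
    [IsFractionRing O F₀] [Field F] [Algebra F₀ F] [Algebra O F] [IsScalarTower O F₀ F]
    (K : RamifiedQuadratic O F₀ F) (m : ℕ)
    (B : Type u) [CommRing B] [Algebra O B]

/-- The coordinates `(u, v)` on `Λ_m ⊗ B`: the element `∑ u_j b_j + ∑ v_j t b_j`. -/
noncomputable def ofCoords :
    ((Fin (2 * m) → B) × (Fin (2 * m) → B)) ≃ₗ[B] LatticeOver K m B :=
  (LinearEquiv.sumArrowLequivProdArrow (Fin (2 * m)) (Fin (2 * m)) B B).symm ≪≫ₗ
    ((latticeBasis K m).baseChange B).equivFun.symm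

theorem ofCoords_apply (w : (Fin (2 * m) → B) × (Fin (2 * m) → B)) :
    ofCoords K m B w = ∑ j, w.1 j • ((1 : B) ⊗ₜ[O] latBasis K m j) +
      ∑ j, w.2 j • ((1 : B) ⊗ₜ[O] tMap K m (latBasis K m j)) := by
  rw [ofCoords, LinearEquiv.trans_apply, Module.Basis.equivFun_symm_apply, Fintype.sum_sum_type]
  simp only [Module.Basis.baseChange_apply, latticeBasis_inl, latticeBasis_inr]
  rfl

theorem ofCoords_single_left (j : Fin (2 * m)) :
    ofCoords K m B (Pi.single j 1, 0) = (1 : B) ⊗ₜ[O] latBasis K m j := by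
  rw [ofCoords_apply]
  simp [Pi.single_apply]

theorem ofCoords_single_right (j : Fin (2 * m)) :
    ofCoords K m B (0, Pi.single j 1) = (1 : B) ⊗ₜ[O] tMap K m (latBasis K m j) := by
  rw [ofCoords_apply]
  simp [Pi.single_apply]

/-- In coordinates `t (u, v) = (π₀ v, u)`. -/
theorem tOver_ofCoords (w : (Fin (2 * m) → B) × (Fin (2 * m) → B)) :
    tOver K m B (ofCoords K m B w) = ofCoords K m B (algebraMap O B K.π₀ • w.2, w.1) := by
  have h : ∀ j, (1 : B) ⊗ₜ[O] tMap K m (tMap K m (latBasis K m j)) =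
      algebraMap O B K.π₀ • ((1 : B) ⊗ₜ[O] latBasis K m j) := by
    intro j
    rw [tMap_tMap, TensorProduct.tmul_smul, algebraMap_smul]
  rw [ofCoords_apply, ofCoords_apply]
  simp only [map_add, map_sum, map_smul, tOver, LinearMap.baseChange_tmul, h, Pi.smul_apply,
    smul_eq_mul, mul_comm (algebraMap O B K.π₀), mul_smul]
  rw [add_comm]

theorem baseChange_latForm_ofCoords (w z : (Fin (2 * m) → B) × (Fin (2 * m) → B)) :
    (latForm K m).baseChange B (ofCoords K m B w) (ofCoords K m B z) =
      ∑ i, rowSign B i * (w.1 i * z.2 (Fin.rev i) - w.2 i * z.1 (Fin.rev i)) := by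
  have h1 : ∀ i : Fin (2 * m), rowSign O i • (1 : B) = rowSign B i := fun i => by
    rw [← map_rowSign (algebraMap O B) i, Algebra.smul_def, mul_one]
  rw [ofCoords_apply, ofCoords_apply]
  simp only [map_add, map_sum, map_smul, LinearMap.add_apply, LinearMap.sum_apply,
    LinearMap.smul_apply, LinearMap.BilinForm.baseChange_tmul, latForm_basis_basis,
    latForm_basis_t, latForm_t_basis, latForm_t_t, ite_smul, zero_smul, neg_smul,
    mul_one, h1, smul_eq_mul, mul_ite, mul_zero, Finset.mul_sum,
    Finset.sum_const_zero, zero_add, add_zero]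
  refine (congrArg₂ (· + ·) Finset.sum_comm Finset.sum_comm).trans ?_
  simp only [Finset.sum_ite_eq', Finset.mem_univ, if_true]
  rw [← Finset.sum_add_distrib]
  exact Finset.sum_congr rfl fun i _ => by ring

variable {B} {C : Type u} [CommRing C] [Algebra O C]

theorem map_ofCoords (f : B →ₐ[O] C) (w : (Fin (2 * m) → B) × (Fin (2 * m) → B)) :
    TensorProduct.map f.toLinearMap (LinearMap.id : lattice K m →ₗ[O] lattice K m)
      (ofCoords K m B w) = ofCoords K m C (f ∘ w.1, f ∘ w.2) := by
  rw [ofCoords_apply, ofCoords_apply]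
  simp [TensorProduct.smul_tmul']

theorem map_smul_map (f : B →ₐ[O] C) (b : B) (x : LatticeOver K m B) :
    TensorProduct.map f.toLinearMap (LinearMap.id : lattice K m →ₗ[O] lattice K m) (b • x) =
      f b • TensorProduct.map f.toLinearMap (LinearMap.id : lattice K m →ₗ[O] lattice K m) x := by
  obtain ⟨w, rfl⟩ := (ofCoords K m B).surjective x
  rw [← map_smul, map_ofCoords, map_ofCoords, ← map_smul]
  congr 1
  ext <;> simp

theorem extend_span (f : B →ₐ[O] C) (S : Set (LatticeOver K m B)) :
    extend K m f (Submodule.span B S) = Submodule.span C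
      (TensorProduct.map f.toLinearMap (LinearMap.id : lattice K m →ₗ[O] lattice K m) '' S) := by
  refine le_antisymm (Submodule.span_le.2 ?_)
    (Submodule.span_mono (Set.image_mono Submodule.subset_span))
  rintro _ ⟨x, hx, rfl⟩
  induction hx using Submodule.span_induction with
  | mem x h => exact Submodule.subset_span ⟨x, h, rfl⟩
  | zero => rw [map_zero]; exact Submodule.zero_mem _
  | add x y _ _ hx hy => rw [map_add]; exact Submodule.add_mem _ hx hy
  | smul a x _ hx =>
    rw [map_smul_map]
    exact Submodule.smul_mem _ _ hx

theorem extend_extend {D : Type u} [CommRing D] [Algebra O D] (f : B →ₐ[O] C) (g : C →ₐ[O] D)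
    (N : Submodule B (LatticeOver K m B)) :
    extend K m g (extend K m f N) = extend K m (g.comp f) N := by
  conv_lhs => rw [extend.eq_def K m f N, extend_span, Set.image_image]
  rw [extend]
  congr 1
  refine Set.image_congr fun x _ => ?_
  obtain ⟨w, rfl⟩ := (ofCoords K m B).surjective x
  rw [map_ofCoords, map_ofCoords, map_ofCoords]
  rfl

/-! ### Complements and minors -/

variable {k : ℕ} (B)

/-- The coordinates of an element along `t b_{i_1}, …, t b_{i_k}`. The kernel is `minorSpan`. -/
noncomputable def lowerProj (i : Fin k ↪ Fin (2 * m)) : LatticeOver K m B →ₗ[B] (Fin k → B) :=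
  (LinearMap.funLeft B B i ∘ₗ LinearMap.snd B _ _) ∘ₗ (ofCoords K m B).symm.toLinearMap

variable {B} in
theorem lowerProj_ofCoords (i : Fin k ↪ Fin (2 * m))
    (w : (Fin (2 * m) → B) × (Fin (2 * m) → B)) :
    lowerProj K m B i (ofCoords K m B w) = w.2 ∘ i := by
  simp only [lowerProj, LinearMap.comp_apply, LinearEquiv.coe_coe, LinearEquiv.symm_apply_apply]
  rfl

theorem ker_lowerProj (i : Fin k ↪ Fin (2 * m)) :
    LinearMap.ker (lowerProj K m B i) = minorSpan K m i B := by
  apply le_antisymm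
  · intro x hx
    obtain ⟨w, rfl⟩ := (ofCoords K m B).surjective x
    rw [LinearMap.mem_ker, lowerProj_ofCoords] at hx
    rw [ofCoords_apply]
    refine Submodule.add_mem_sup (Submodule.sum_mem _ fun j _ => Submodule.smul_mem _ _
      (Submodule.subset_span ⟨j, rfl⟩)) (Submodule.sum_mem _ fun j _ => ?_)
    by_cases hj : j ∈ Set.range i
    · obtain ⟨l, rfl⟩ := hj
      have : w.2 (i l) = 0 := congrFun hx l
      rw [this, zero_smul]
      exact Submodule.zero_mem _
    · exact Submodule.smul_mem _ _ (Submodule.subset_span ⟨j, hj, rfl⟩)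
  · refine sup_le (Submodule.span_le.2 ?_) (Submodule.span_le.2 ?_)
    · rintro _ ⟨j, rfl⟩
      simp only [SetLike.mem_coe, LinearMap.mem_ker]
      rw [← ofCoords_single_left, lowerProj_ofCoords]
      rfl
    · rintro _ ⟨j, hj, rfl⟩
      simp only [SetLike.mem_coe, LinearMap.mem_ker]
      rw [← ofCoords_single_right, lowerProj_ofCoords]
      funext l
      exact Pi.single_eq_of_ne (fun h => hj ⟨l, h⟩) 1

theorem minorSpan_refl :
    minorSpan K m (Function.Embedding.refl (Fin (2 * m))) B = upperSpan K m B := by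
  have h : (Set.range (Function.Embedding.refl (Fin (2 * m))))ᶜ = ∅ := by
    rw [Set.compl_empty_iff, Set.range_eq_univ]
    exact fun j => ⟨j, rfl⟩
  rw [minorSpan, h, Set.image_empty, Submodule.span_empty, sup_bot_eq]

theorem lowerProj_surjective (i : Fin k ↪ Fin (2 * m)) :
    Function.Surjective (lowerProj K m B i) := by
  intro v
  refine ⟨ofCoords K m B (0, Function.extend i v 0), ?_⟩
  rw [lowerProj_ofCoords]
  exact Function.extend_comp i.injective v 0

variable {B}

/-- Some `k × k` minor formed by the rows `t b_{i_1}, …, t b_{i_k}` of `k` elements of `N` does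
not lie in the prime `q`. Over the residue field of `q`, this says that `N` maps onto the
quotient of `Λ_m ⊗ B` by `minorSpan`. No generators of `N` are chosen, so that the notion makes
sense before `N` is known to be free. -/
def MinorAt (i : Fin k ↪ Fin (2 * m)) (N : Submodule B (LatticeOver K m B))
    (q : PrimeSpectrum B) : Prop :=
  ∃ v : Fin k → LatticeOver K m B, (∀ j, v j ∈ N) ∧
    (Matrix.of fun j => lowerProj K m B i (v j)).det ∉ q.asIdeal

variable {K m}

/-- A direct summand of rank `k` that maps onto `B ^ k` is a complement of the kernel: a
surjection between finite projective modules of the same rank is injective. -/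
theorem isCompl_of_surjective {N : Submodule B (LatticeOver K m B)} (hN : ∃ G, IsCompl N G)
    (hr : ∀ q : PrimeSpectrum B, Module.rankAtStalk N q = k) (i : Fin k ↪ Fin (2 * m))
    (h : ∀ v, ∃ x ∈ N, lowerProj K m B i x = v) : IsCompl N (minorSpan K m i B) := by
  obtain ⟨G, hG⟩ := hN
  have hL : Module.Free B (LatticeOver K m B) := Module.Free.of_equiv (ofCoords K m B)
  have hLf : Module.Finite B (LatticeOver K m B) :=
    Module.Finite.equiv (ofCoords K m B)
  have hs : Function.Surjective (N.projectionOnto G hG) := by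
    intro x
    exact ⟨x, Submodule.projectionOnto_apply_left hG x⟩
  have hf : Module.Finite B N := Module.Finite.of_surjective _ hs
  have hp : Module.Projective B N := by
    refine Module.Projective.of_split N.subtype (N.projectionOnto G hG) ?_
    ext x
    simp
  have hfl : Module.Flat B N := Module.Flat.of_projective
  have hb : Function.Bijective ((lowerProj K m B i).domRestrict N) := by
    refine Module.bijective_of_surjective_of_rankAtStalk_eq (R := B) (M := N)
      (N := Fin k → B) ?_ ?_
    · intro v
      obtain ⟨x, hx, rfl⟩ := h v
      exact ⟨⟨x, hx⟩, rfl⟩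
    · intro p _
      have : Nontrivial B := ⟨0, 1, fun h => (‹p.IsMaximal›.ne_top)
        ((Ideal.eq_top_iff_one p).2 (h ▸ p.zero_mem))⟩
      rw [hr, Module.rankAtStalk_eq_finrank_of_free]
      simp
  rw [← ker_lowerProj]
  constructor
  · rw [Submodule.disjoint_def]
    intro x hx hx'
    have := @hb.1 ⟨x, hx⟩ 0 (by rw [map_zero]; exact hx')
    exact congrArg Subtype.val this
  · rw [codisjoint_iff_le_sup]
    intro x _
    obtain ⟨y, hy, hxy⟩ := h (lowerProj K m B i x)
    rw [← add_sub_cancel y x]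
    exact Submodule.add_mem_sup hy (by rw [LinearMap.mem_ker, map_sub, hxy, sub_self])

theorem exists_mem_of_isCompl {N : Submodule B (LatticeOver K m B)} {i : Fin k ↪ Fin (2 * m)}
    (h : IsCompl N (minorSpan K m i B)) (v : Fin k → B) :
    ∃ x ∈ N, lowerProj K m B i x = v := by
  obtain ⟨y, rfl⟩ := lowerProj_surjective K m B i v
  have hy : y ∈ N ⊔ minorSpan K m i B := by rw [h.sup_eq_top]; trivial
  obtain ⟨x, hx, z, hz, rfl⟩ := Submodule.mem_sup.1 hy
  rw [← ker_lowerProj] at hz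
  exact ⟨x, hx, by rw [map_add, LinearMap.mem_ker.1 hz, add_zero]⟩

/-- Being a complement of `minorSpan` can be tested by minors at each prime: the scalars `c` such
that the image of `N` contains `c B ^ k` form an ideal, which contains all minors by Cramer's
rule. -/
theorem isCompl_minorSpan_iff {N : Submodule B (LatticeOver K m B)} (hN : ∃ G, IsCompl N G)
    (hr : ∀ q : PrimeSpectrum B, Module.rankAtStalk N q = k) (i : Fin k ↪ Fin (2 * m)) :
    IsCompl N (minorSpan K m i B) ↔ ∀ q, MinorAt K m i N q := by
  constructor
  · intro h q
    choose v hv hv' using fun j : Fin k => exists_mem_of_isCompl h (Pi.single j 1)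
    refine ⟨v, hv, ?_⟩
    have e : (Matrix.of fun j => lowerProj K m B i (v j)) = 1 := by
      ext a b
      rw [Matrix.of_apply, hv', Matrix.one_apply, Pi.single_apply]
      simp only [eq_comm]
    rw [e, Matrix.det_one]
    exact fun h1 => q.isPrime.ne_top ((Ideal.eq_top_iff_one _).2 h1)
  · intro h
    apply isCompl_of_surjective hN hr
    let I : Ideal B :=
      { carrier := {c | ∀ v, ∃ x ∈ N, lowerProj K m B i x = c • v}
        add_mem' := by
          intro a b ha hb v
          obtain ⟨x, hx, hx'⟩ := ha v
          obtain ⟨y, hy, hy'⟩ := hb v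
          exact ⟨x + y, N.add_mem hx hy, by rw [map_add, hx', hy', add_smul]⟩
        zero_mem' := fun v => ⟨0, N.zero_mem, by simp⟩
        smul_mem' := by
          intro a b hb v
          obtain ⟨y, hy, hy'⟩ := hb v
          exact ⟨a • y, N.smul_mem _ hy, by rw [map_smul, hy', smul_smul, smul_eq_mul]⟩ }
    have hI : I = ⊤ := by
      by_contra hI
      obtain ⟨M, hM, hIM⟩ := Ideal.exists_le_maximal I hI
      obtain ⟨v, hv, hd⟩ := h ⟨M, hM.isPrime⟩
      refine hd (hIM ?_)
      intro w
      set A := Matrix.of fun j => lowerProj K m B i (v j)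
      refine ⟨∑ j, (Matrix.vecMul w A.adjugate) j • v j,
        N.sum_mem fun j _ => N.smul_mem _ (hv j), ?_⟩
      have e : lowerProj K m B i (∑ j, (Matrix.vecMul w A.adjugate) j • v j) =
          Matrix.vecMul (Matrix.vecMul w A.adjugate) A := by
        simp only [map_sum, map_smul, Matrix.vecMul_eq_sum]
        rfl
      rw [e, Matrix.vecMul_vecMul, Matrix.adjugate_mul, Matrix.vecMul_smul, Matrix.vecMul_one]
    intro v
    have h1 : (1 : B) ∈ I := by rw [hI]; trivial
    simpa using h1 v

theorem lowerProj_map (f : B →ₐ[O] C) (i : Fin k ↪ Fin (2 * m)) (x : LatticeOver K m B) :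
    lowerProj K m C i (TensorProduct.map f.toLinearMap
      (LinearMap.id : lattice K m →ₗ[O] lattice K m) x) = f ∘ lowerProj K m B i x := by
  obtain ⟨w, rfl⟩ := (ofCoords K m B).surjective x
  rw [map_ofCoords, lowerProj_ofCoords, lowerProj_ofCoords]
  rfl

/-- The condition on minors is compatible with base change. A minor of elements of the span of
the image of `N` is, by multilinearity, a combination of minors of elements of the image itself. -/
theorem minorAt_extend_iff (f : B →ₐ[O] C) (i : Fin k ↪ Fin (2 * m))
    (N : Submodule B (LatticeOver K m B)) (q : PrimeSpectrum C) :
    MinorAt K m i (extend K m f N) q ↔ MinorAt K m i N (q.comap (f : B →+* C)) := by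
  have hdet : ∀ v : Fin k → LatticeOver K m B,
      (Matrix.of fun j => lowerProj K m C i (TensorProduct.map f.toLinearMap
        (LinearMap.id : lattice K m →ₗ[O] lattice K m) (v j))).det =
      f (Matrix.of fun j => lowerProj K m B i (v j)).det := by
    intro v
    rw [AlgHom.map_det]
    congr 1
    ext a b
    simp only [Matrix.of_apply, lowerProj_map]
    rfl
  constructor
  · contrapose!
    intro h
    -- By induction on the set `s` of rows that are allowed to lie in the span, the others being in
    -- the image of `N`.
    have key : ∀ s : Finset (Fin k), ∀ v : Fin k → LatticeOver K m C,
        (∀ j ∈ s, v j ∈ extend K m f N) →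
        (∀ j ∉ s, v j ∈ TensorProduct.map f.toLinearMap
          (LinearMap.id : lattice K m →ₗ[O] lattice K m) '' (N : Set (LatticeOver K m B))) →
        (Matrix.of fun j => lowerProj K m C i (v j)).det ∈ q.asIdeal := by
      intro s
      induction s using Finset.induction_on with
      | empty =>
        intro v _ hv
        choose w hw hw' using fun j => hv j (Finset.notMem_empty j)
        by_contra hq
        refine h ⟨w, hw, ?_⟩
        intro hmem
        apply hq
        have : v = fun j => TensorProduct.map f.toLinearMap
          (LinearMap.id : lattice K m →ₗ[O] lattice K m) (w j) := funext fun j => (hw' j).symm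
        rw [this, hdet]
        exact hmem
      | insert a s ha ih =>
        intro v hv hv'
        have hupd : ∀ x, (Matrix.of fun j => lowerProj K m C i (Function.update v a x j)) =
            (Matrix.of fun j => lowerProj K m C i (v j)).updateRow a (lowerProj K m C i x) := by
          intro x
          ext j l
          by_cases hj : j = a
          · subst hj; simp
          · simp [hj]
        have h2 : ∀ x ∈ extend K m f N,
            (Matrix.of fun j => lowerProj K m C i (Function.update v a x j)).det ∈ q.asIdeal := by
          intro x hx
          induction hx using Submodule.span_induction with
          | mem x hx =>
            apply ih
            · intro j hj
              rw [Function.update_of_ne (ne_of_mem_of_not_mem hj ha)]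
              exact hv j (Finset.mem_insert_of_mem hj)
            · intro j hj
              by_cases hja : j = a
              · subst hja; rw [Function.update_self]; exact hx
              · rw [Function.update_of_ne hja]
                exact hv' j (by simp [hja, hj])
          | zero =>
            rw [hupd, map_zero, Matrix.det_eq_zero_of_row_eq_zero a (by simp)]
            exact q.asIdeal.zero_mem
          | add x y _ _ hx hy =>
            rw [hupd] at hx hy ⊢
            rw [map_add, Matrix.det_updateRow_add]
            exact q.asIdeal.add_mem hx hy
          | smul c x _ hx =>
            rw [hupd] at hx ⊢
            rw [map_smul, Matrix.det_updateRow_smul]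
            exact q.asIdeal.mul_mem_left c hx
        have h3 := h2 (v a) (hv a (Finset.mem_insert_self a s))
        rwa [Function.update_eq_self] at h3
    rintro ⟨v, hv, hd⟩
    exact hd (key Finset.univ v (fun j _ => hv j) (fun j hj => absurd (Finset.mem_univ j) hj))
  · rintro ⟨v, hv, hd⟩
    refine ⟨fun j => TensorProduct.map f.toLinearMap
      (LinearMap.id : lattice K m →ₗ[O] lattice K m) (v j),
      fun j => Submodule.subset_span ⟨v j, hv j, rfl⟩, ?_⟩
    rw [hdet]
    exact hd

end Coordinates

/-! ### The matrix equations of the chart -/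

section Matrices

variable {R : Type u} [CommRing R] {m s : ℕ}

/-- The antidiagonal matrix `J` with `J Y = Ỹ` for every `Y`; it is skew with `J² = -1`. -/
noncomputable def antiJ (R : Type u) [CommRing R] (m : ℕ) :
    Matrix (Fin (2 * m)) (Fin (2 * m)) R := yTilde 1

theorem yTilde_apply (Y : Matrix (Fin (2 * m)) (Fin s) R) (p : Fin (2 * m)) (q : Fin s) :
    yTilde Y p q = -rowSign R p * Y (Fin.rev p) q := by
  unfold yTilde rowSign
  rw [Matrix.of_apply]
  split_ifs <;> ring

theorem antiJ_mul (Y : Matrix (Fin (2 * m)) (Fin s) R) : antiJ R m * Y = yTilde Y := by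
  ext p q
  rw [Matrix.mul_apply, Finset.sum_eq_single (Fin.rev p)]
  · rw [antiJ, yTilde_apply, yTilde_apply, Matrix.one_apply_eq, mul_one]
  · intro k _ hk
    rw [antiJ, yTilde_apply, Matrix.one_apply_ne (Ne.symm hk), mul_zero, zero_mul]
  · simp

theorem antiJ_mul_antiJ : antiJ R m * antiJ R m = -1 := by
  rw [antiJ_mul]
  ext p q
  rw [antiJ, yTilde_apply, yTilde_apply, rowSign_rev, Fin.rev_rev, Matrix.neg_apply]
  linear_combination (-(1 : Matrix (Fin (2 * m)) (Fin (2 * m)) R) p q) * rowSign_mul_self (R := R) p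

theorem antiJ_transpose : (antiJ R m).transpose = -antiJ R m := by
  ext p q
  rw [Matrix.transpose_apply, Matrix.neg_apply, antiJ, yTilde_apply, yTilde_apply,
    Matrix.one_apply, Matrix.one_apply]
  by_cases h : Fin.rev q = p
  · subst h
    rw [Fin.rev_rev, if_pos rfl, if_pos rfl, rowSign_rev]; ring
  · rw [if_neg h, if_neg (fun h' => h (by rw [← h', Fin.rev_rev]))]; ring

theorem yTilde_map {R' : Type u} [CommRing R'] (f : R →+* R')
    (Y : Matrix (Fin (2 * m)) (Fin s) R) : yTilde (Y.map f) = (yTilde Y).map f := by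
  ext p q
  simp only [yTilde_apply, Matrix.map_apply, map_mul, map_neg, map_rowSign]

theorem map_smul_one {R' : Type u} [CommRing R'] (f : R →+* R') {k : ℕ} (a : R) :
    (a • (1 : Matrix (Fin k) (Fin k) R)).map f = f a • 1 := by
  ext p q
  simp only [Matrix.map_apply, Matrix.smul_apply, Matrix.one_apply, smul_eq_mul, mul_ite, mul_one,
    mul_zero, apply_ite f, map_zero]

/-- The pair `(D, Y)` satisfies the equations `Y' = 1`, `D + Dᵗ = 0` and `D Ỹᵗ Y + 2 ϖ = 0` of
the chart. -/
structure IsChartDatum (ϖ : R) (i : Fin s ↪ Fin (2 * m)) (D : Matrix (Fin s) (Fin s) R)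
    (Y : Matrix (Fin (2 * m)) (Fin s) R) : Prop where
  submatrix_eq : Y.submatrix i id = 1
  skew : D + D.transpose = 0
  mul_eq : D * ((yTilde Y).transpose * Y) + (2 * ϖ) • (1 : Matrix (Fin s) (Fin s) R) = 0

theorem IsChartDatum.map {R' : Type u} [CommRing R'] (f : R →+* R') {ϖ : R}
    {i : Fin s ↪ Fin (2 * m)} {D : Matrix (Fin s) (Fin s) R}
    {Y : Matrix (Fin (2 * m)) (Fin s) R} (h : IsChartDatum ϖ i D Y) :
    IsChartDatum (f ϖ) i (D.map f) (Y.map f) where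
  submatrix_eq := by
    have := congrArg (fun A => A.map f) h.submatrix_eq
    rwa [Matrix.map_one _ (map_zero f) (map_one f)] at this
  skew := by
    have := congrArg (fun A => A.map f) h.skew
    rwa [Matrix.map_add _ (map_add f), Matrix.map_zero _ (map_zero f), Matrix.transpose_map]
      at this
  mul_eq := by
    have := congrArg (fun A => A.map f) h.mul_eq
    simp only [Matrix.map_add _ (map_add f), Matrix.map_zero _ (map_zero f), Matrix.map_mul,
      map_smul_one, map_mul, map_ofNat, Matrix.transpose_map, ← yTilde_map] at this
    exact this

/-- The matrix `X = -Y D Ỹᵗ - ϖ` for which `F_1` consists of the elements with coordinates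
`(X v, v)`. -/
noncomputable def upperBlock (ϖ : R) (D : Matrix (Fin s) (Fin s) R)
    (Y : Matrix (Fin (2 * m)) (Fin s) R) : Matrix (Fin (2 * m)) (Fin (2 * m)) R :=
  -(Y * D * (yTilde Y).transpose) - ϖ • 1

theorem upperBlock_map {R' : Type u} [CommRing R'] (f : R →+* R') (ϖ : R)
    (D : Matrix (Fin s) (Fin s) R) (Y : Matrix (Fin (2 * m)) (Fin s) R) :
    upperBlock (f ϖ) (D.map f) (Y.map f) = (upperBlock ϖ D Y).map f := by
  simp only [upperBlock, yTilde_map, Matrix.map_sub _ (map_sub f), Matrix.map_neg _ (map_neg f),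
    Matrix.map_mul, Matrix.transpose_map, map_smul_one]

theorem one_submatrix_mul (i : Fin s ↪ Fin (2 * m)) {k : ℕ}
    (Y : Matrix (Fin (2 * m)) (Fin k) R) :
    (1 : Matrix (Fin (2 * m)) (Fin (2 * m)) R).submatrix i id * Y = Y.submatrix i id := by
  have := Matrix.submatrix_mul (1 : Matrix (Fin (2 * m)) (Fin (2 * m)) R) Y i id id
    Function.bijective_id
  rw [Matrix.one_mul] at this
  exact this.symm

theorem exists_mul_eq_one {i : Fin s ↪ Fin (2 * m)} {Y : Matrix (Fin (2 * m)) (Fin s) R}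
    (h : Y.submatrix i id = 1) : ∃ S : Matrix (Fin s) (Fin (2 * m)) R, S * Y = 1 :=
  ⟨_, (one_submatrix_mul i Y).trans h⟩

/-- The matrix `Ỹ = J Y` has a left inverse because `Y` does. -/
theorem exists_mul_yTilde_eq_one {i : Fin s ↪ Fin (2 * m)} {Y : Matrix (Fin (2 * m)) (Fin s) R}
    (h : Y.submatrix i id = 1) : ∃ S : Matrix (Fin s) (Fin (2 * m)) R, S * yTilde Y = 1 := by
  obtain ⟨S, hS⟩ := exists_mul_eq_one h
  refine ⟨-(S * antiJ R m), ?_⟩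
  rw [← antiJ_mul, Matrix.neg_mul, Matrix.mul_assoc, ← Matrix.mul_assoc (antiJ R m),
    antiJ_mul_antiJ, Matrix.neg_mul, Matrix.one_mul, Matrix.mul_neg, neg_neg, hS]

theorem yTilde_mul {k : ℕ} (Y : Matrix (Fin (2 * m)) (Fin s) R) (Z : Matrix (Fin s) (Fin k) R) :
    yTilde (Y * Z) = yTilde Y * Z := by
  rw [← antiJ_mul, ← antiJ_mul, Matrix.mul_assoc]

theorem yTilde_upperBlock (ϖ : R) (D : Matrix (Fin s) (Fin s) R)
    (Y : Matrix (Fin (2 * m)) (Fin s) R) :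
    yTilde (upperBlock ϖ D Y) = -(yTilde Y * D * (yTilde Y).transpose) - ϖ • antiJ R m := by
  rw [← antiJ_mul, upperBlock, Matrix.mul_sub, Matrix.mul_neg, Matrix.mul_smul, Matrix.mul_one,
    ← Matrix.mul_assoc, ← Matrix.mul_assoc, antiJ_mul]

theorem IsChartDatum.transpose_eq_neg {ϖ : R} {i : Fin s ↪ Fin (2 * m)}
    {D : Matrix (Fin s) (Fin s) R} {Y : Matrix (Fin (2 * m)) (Fin s) R}
    (h : IsChartDatum ϖ i D Y) :
    (yTilde (upperBlock ϖ D Y)).transpose = -yTilde (upperBlock ϖ D Y) := by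
  have hD : D.transpose = -D := (neg_eq_of_add_eq_zero_right h.skew).symm
  rw [yTilde_upperBlock]
  simp only [Matrix.transpose_sub, Matrix.transpose_neg, Matrix.transpose_mul,
    Matrix.transpose_transpose, Matrix.transpose_smul, antiJ_transpose, hD, Matrix.mul_assoc,
    Matrix.neg_mul, Matrix.mul_neg, smul_neg]
  abel

theorem IsChartDatum.upperBlock_mul {ϖ : R} {i : Fin s ↪ Fin (2 * m)}
    {D : Matrix (Fin s) (Fin s) R} {Y : Matrix (Fin (2 * m)) (Fin s) R}
    (h : IsChartDatum ϖ i D Y) : upperBlock ϖ D Y * Y = ϖ • Y := by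
  have h1 : D * ((yTilde Y).transpose * Y) = -((2 * ϖ) • (1 : Matrix (Fin s) (Fin s) R)) :=
    eq_neg_of_add_eq_zero_left h.mul_eq
  rw [upperBlock, Matrix.sub_mul, Matrix.neg_mul, Matrix.mul_assoc, Matrix.mul_assoc, h1,
    Matrix.mul_neg, neg_neg, Matrix.mul_smul, Matrix.mul_one, Matrix.smul_mul, Matrix.one_mul,
    two_mul ϖ, add_smul, add_sub_cancel_right]

/-- If `J X` is skew, `X Y = ϖ Y` and `X + ϖ = Y Z`, then `X` comes from a chart datum. Skewness of
`Ỹ Z = J X + ϖ J` together with a left inverse `S` of `Ỹ` gives `Z = -D Ỹᵗ` with `D = S Zᵗ`; then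
`D` is skew, and `Z Y = 2 ϖ` is the last equation. -/
theorem exists_isChartDatum {ϖ : R} {i : Fin s ↪ Fin (2 * m)}
    {X : Matrix (Fin (2 * m)) (Fin (2 * m)) R} {Y : Matrix (Fin (2 * m)) (Fin s) R}
    {Z : Matrix (Fin s) (Fin (2 * m)) R}
    (hY : Y.submatrix i id = 1) (hX : (yTilde X).transpose = -yTilde X)
    (hXY : X * Y = ϖ • Y) (hZ : X + ϖ • 1 = Y * Z) :
    ∃ D, IsChartDatum ϖ i D Y ∧ upperBlock ϖ D Y = X := by
  obtain ⟨S, hS⟩ := exists_mul_yTilde_eq_one hY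
  obtain ⟨S₀, hS₀⟩ := exists_mul_eq_one hY
  have h1 : yTilde Y * Z = yTilde X + ϖ • antiJ R m := by
    rw [← yTilde_mul, ← hZ, ← antiJ_mul, ← antiJ_mul, Matrix.mul_add, Matrix.mul_smul,
      Matrix.mul_one]
  have h2 : Z.transpose * (yTilde Y).transpose = -(yTilde Y * Z) := by
    rw [← Matrix.transpose_mul, h1, Matrix.transpose_add, Matrix.transpose_smul, hX,
      antiJ_transpose, smul_neg, neg_add]
  have h3 : Z = -(S * Z.transpose * (yTilde Y).transpose) := by
    rw [Matrix.mul_assoc, h2, Matrix.mul_neg, neg_neg, ← Matrix.mul_assoc, hS, Matrix.one_mul]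
  have h4 : upperBlock ϖ (S * Z.transpose) Y = X := by
    rw [upperBlock, Matrix.mul_assoc, ← Matrix.mul_neg, ← h3, ← hZ, add_sub_cancel_right]
  refine ⟨S * Z.transpose, ⟨hY, ?_, ?_⟩, h4⟩
  · have hST : (yTilde Y).transpose * S.transpose = 1 := by
      rw [← Matrix.transpose_mul, hS, Matrix.transpose_one]
    have h5 : Z * S.transpose = -(S * Z.transpose) := by
      conv_lhs => rw [h3]
      rw [Matrix.neg_mul, Matrix.mul_assoc, hST, Matrix.mul_one]
    rw [Matrix.transpose_mul, Matrix.transpose_transpose, h5, add_neg_cancel]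
  · have h6 : Y * (Z * Y) = Y * ((2 * ϖ) • (1 : Matrix (Fin s) (Fin s) R)) := by
      rw [← Matrix.mul_assoc, ← hZ, Matrix.add_mul, hXY, Matrix.smul_mul, Matrix.one_mul,
        Matrix.mul_smul, Matrix.mul_one, two_mul ϖ, add_smul]
    have h7 : Z * Y = (2 * ϖ) • (1 : Matrix (Fin s) (Fin s) R) := by
      have := congrArg (S₀ * ·) h6
      simpa only [← Matrix.mul_assoc, hS₀, Matrix.one_mul] using this
    rw [← h7]
    conv_lhs => enter [2]; rw [h3]
    rw [Matrix.neg_mul, Matrix.mul_assoc (S * Z.transpose), add_neg_cancel]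

theorem upperBlock_left_injective {ϖ : R} {i : Fin s ↪ Fin (2 * m)}
    {D D' : Matrix (Fin s) (Fin s) R} {Y : Matrix (Fin (2 * m)) (Fin s) R}
    (hY : Y.submatrix i id = 1) (h : upperBlock ϖ D Y = upperBlock ϖ D' Y) : D = D' := by
  obtain ⟨S, hS⟩ := exists_mul_yTilde_eq_one hY
  obtain ⟨S₀, hS₀⟩ := exists_mul_eq_one hY
  have hST : (yTilde Y).transpose * S.transpose = 1 := by
    rw [← Matrix.transpose_mul, hS, Matrix.transpose_one]
  have h1 : Y * D * (yTilde Y).transpose = Y * D' * (yTilde Y).transpose :=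
    neg_injective (sub_left_injective h)
  have h2 := congrArg (fun A => S₀ * (A * S.transpose)) h1
  simpa only [Matrix.mul_assoc, hST, Matrix.mul_one, ← Matrix.mul_assoc S₀, hS₀, Matrix.one_mul]
    using h2

end Matrices

/-! ### Submodules spanned by the columns of block matrices -/

section ColumnSpan

variable {O F₀ F : Type u}
    [CommRing O] [IsDomain O] [IsDiscreteValuationRing O] [Field F₀] [Algebra O F₀]
    [IsFractionRing O F₀] [Field F] [Algebra F₀ F] [Algebra O F] [IsScalarTower O F₀ F]
    (K : RamifiedQuadratic O F₀ F) {m k : ℕ}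
    {B : Type u} [CommRing B] [Algebra O B]

/-- The submodule of `Λ_m ⊗ B` spanned by the columns of the block matrix with upper block `A`
and lower block `C`. -/
noncomputable def colSpan (A C : Matrix (Fin (2 * m)) (Fin k) B) :
    Submodule B (LatticeOver K m B) :=
  Submodule.span B (Set.range fun j => ofCoords K m B (fun p => A p j, fun p => C p j))

theorem mem_colSpan (A C : Matrix (Fin (2 * m)) (Fin k) B) (x : LatticeOver K m B) :
    x ∈ colSpan K A C ↔ ∃ a, x = ofCoords K m B (A.mulVec a, C.mulVec a) := by
  have h : ∀ a, ∑ j, a j • ofCoords K m B (fun p => A p j, fun p => C p j) =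
      ofCoords K m B (A.mulVec a, C.mulVec a) := by
    intro a
    simp only [← map_smul, ← map_sum]
    congr 1
    ext p <;>
      simp [Prod.fst_sum, Prod.snd_sum, Matrix.mulVec, dotProduct, mul_comm]
  rw [colSpan, Submodule.mem_span_range_iff_exists_fun]
  exact exists_congr fun a => by rw [h, eq_comm]

theorem ofCoords_mem_colSpan (A C : Matrix (Fin (2 * m)) (Fin k) B)
    (w : (Fin (2 * m) → B) × (Fin (2 * m) → B)) :
    ofCoords K m B w ∈ colSpan K A C ↔ ∃ a, w.1 = A.mulVec a ∧ w.2 = C.mulVec a := by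
  rw [mem_colSpan]
  refine exists_congr fun a => ?_
  rw [(ofCoords K m B).injective.eq_iff, Prod.ext_iff]

theorem ofCoords_mem_colSpan_one (A : Matrix (Fin (2 * m)) (Fin (2 * m)) B)
    (w : (Fin (2 * m) → B) × (Fin (2 * m) → B)) :
    ofCoords K m B w ∈ colSpan K A 1 ↔ w.1 = A.mulVec w.2 := by
  rw [ofCoords_mem_colSpan]
  simp only [Matrix.one_mulVec]
  constructor
  · rintro ⟨a, h1, rfl⟩; exact h1
  · exact fun h => ⟨_, h, rfl⟩

theorem extend_colSpan {C' : Type u} [CommRing C'] [Algebra O C'] (f : B →ₐ[O] C')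
    (A C : Matrix (Fin (2 * m)) (Fin k) B) :
    extend K m f (colSpan K A C) = colSpan K (A.map f) (C.map f) := by
  rw [colSpan, extend_span, ← Set.range_comp, colSpan]
  congr 2
  funext j
  simp only [Function.comp_apply, map_ofCoords]
  rfl

theorem lowerProj_mulVec {i : Fin k ↪ Fin (2 * m)} {A C : Matrix (Fin (2 * m)) (Fin k) B}
    (hC : C.submatrix i id = 1) (a : Fin k → B) :
    lowerProj K m B i (ofCoords K m B (A.mulVec a, C.mulVec a)) = a := by
  rw [lowerProj_ofCoords]
  have : (C.submatrix i id).mulVec a = a := by rw [hC, Matrix.one_mulVec]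
  exact this

/-- When the rows `i_1, …, i_k` of the lower block form the identity matrix, the columns form a
basis of their span, and the coordinates are read off in these rows. -/
noncomputable def colSpanEquiv {i : Fin k ↪ Fin (2 * m)} {A C : Matrix (Fin (2 * m)) (Fin k) B}
    (hC : C.submatrix i id = 1) : colSpan K A C ≃ₗ[B] (Fin k → B) :=
  LinearEquiv.ofBijective ((lowerProj K m B i).domRestrict (colSpan K A C)) (by
    constructor
    · refine (injective_iff_map_eq_zero _).2 ?_
      rintro ⟨x, hx⟩ h
      obtain ⟨a, rfl⟩ := (mem_colSpan K A C x).1 hx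
      have h' : lowerProj K m B i (ofCoords K m B (A.mulVec a, C.mulVec a)) = 0 := h
      rw [lowerProj_mulVec K hC] at h'
      subst h'
      apply Subtype.ext
      simp
    · intro a
      exact ⟨⟨_, (mem_colSpan K A C _).2 ⟨a, rfl⟩⟩, lowerProj_mulVec K hC a⟩)

theorem rankAtStalk_colSpan {i : Fin k ↪ Fin (2 * m)} {A C : Matrix (Fin (2 * m)) (Fin k) B}
    (hC : C.submatrix i id = 1) (q : PrimeSpectrum B) :
    Module.rankAtStalk (colSpan K A C) q = k := by
  have : Nontrivial B := q.nontrivial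
  rw [Module.rankAtStalk_eq_of_equiv (colSpanEquiv K hC), Module.rankAtStalk_eq_finrank_of_free]
  simp

theorem isCompl_colSpan {i : Fin k ↪ Fin (2 * m)} {A C : Matrix (Fin (2 * m)) (Fin k) B}
    (hC : C.submatrix i id = 1) : IsCompl (colSpan K A C) (minorSpan K m i B) := by
  rw [← ker_lowerProj]
  constructor
  · rw [Submodule.disjoint_def]
    intro x hx hx'
    obtain ⟨a, rfl⟩ := (mem_colSpan K A C x).1 hx
    rw [LinearMap.mem_ker, lowerProj_mulVec K hC] at hx'
    subst hx'
    simp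
  · rw [codisjoint_iff_le_sup]
    intro x _
    set a := lowerProj K m B i x
    rw [← add_sub_cancel (ofCoords K m B (A.mulVec a, C.mulVec a)) x]
    refine Submodule.add_mem_sup ((mem_colSpan K A C _).2 ⟨a, rfl⟩) ?_
    rw [LinearMap.mem_ker, map_sub, lowerProj_mulVec K hC, sub_self]

theorem isCompl_colSpan_one (A : Matrix (Fin (2 * m)) (Fin (2 * m)) B) :
    IsCompl (colSpan K A 1) (upperSpan K m B) := by
  rw [← minorSpan_refl]
  exact isCompl_colSpan K (by rfl)

/-- A complement of `minorSpan` is spanned by the columns of a block matrix in whose lower block the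
rows `i_1, …, i_k` form the identity matrix. -/
theorem exists_eq_colSpan {i : Fin k ↪ Fin (2 * m)} {N : Submodule B (LatticeOver K m B)}
    (h : IsCompl N (minorSpan K m i B)) :
    ∃ A C : Matrix (Fin (2 * m)) (Fin k) B, C.submatrix i id = 1 ∧ N = colSpan K A C := by
  choose v hv hv' using fun j : Fin k => exists_mem_of_isCompl h (Pi.single j 1)
  let A : Matrix (Fin (2 * m)) (Fin k) B := .of fun p j => ((ofCoords K m B).symm (v j)).1 p
  let C : Matrix (Fin (2 * m)) (Fin k) B := .of fun p j => ((ofCoords K m B).symm (v j)).2 p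
  have hvj : ∀ j, ofCoords K m B (fun p => A p j, fun p => C p j) = v j := fun j =>
    (ofCoords K m B).apply_symm_apply (v j)
  have hC : C.submatrix i id = 1 := by
    ext a b
    have h1 := congrFun (hv' b) a
    rw [← hvj, lowerProj_ofCoords] at h1
    rw [Matrix.one_apply]
    refine Eq.trans h1 ?_
    rw [Pi.single_apply]
  refine ⟨A, C, hC, le_antisymm ?_ (Submodule.span_le.2 ?_)⟩
  · intro x hx
    have hle : colSpan K A C ≤ N := by
      refine Submodule.span_le.2 ?_
      rintro _ ⟨j, rfl⟩
      simp only [hvj]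
      exact hv j
    obtain ⟨y, hy, z, hz, rfl⟩ := Submodule.mem_sup.1
      (show x ∈ colSpan K A C ⊔ minorSpan K m i B by
        rw [(isCompl_colSpan K hC).sup_eq_top]; trivial)
    have hzN : z ∈ N := by simpa using N.sub_mem hx (hle hy)
    have : z = 0 := Submodule.disjoint_def.1 h.disjoint z hzN hz
    rw [this, add_zero]
    exact hy
  · rintro _ ⟨j, rfl⟩
    simp only [hvj]
    exact hv j

theorem exists_eq_colSpan_one {N : Submodule B (LatticeOver K m B)}
    (h : IsCompl N (upperSpan K m B)) :
    ∃ A : Matrix (Fin (2 * m)) (Fin (2 * m)) B, N = colSpan K A 1 := by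
  rw [← minorSpan_refl] at h
  obtain ⟨A, C, hC, rfl⟩ := exists_eq_colSpan K h
  have : C = 1 := hC
  exact ⟨A, by rw [this]⟩

theorem colSpan_injective {i : Fin k ↪ Fin (2 * m)} {A C A' C' : Matrix (Fin (2 * m)) (Fin k) B}
    (hC : C.submatrix i id = 1) (hC' : C'.submatrix i id = 1)
    (h : colSpan K A C = colSpan K A' C') : A = A' ∧ C = C' := by
  have key : ∀ j, A.mulVec (Pi.single j 1) = A'.mulVec (Pi.single j 1) ∧
      C.mulVec (Pi.single j 1) = C'.mulVec (Pi.single j 1) := by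
    intro j
    have h1 : ofCoords K m B (A.mulVec (Pi.single j 1), C.mulVec (Pi.single j 1)) ∈
        colSpan K A' C' := by
      rw [← h]; exact (mem_colSpan K _ _ _).2 ⟨_, rfl⟩
    obtain ⟨a, ha⟩ := (mem_colSpan K _ _ _).1 h1
    have ha' := ha
    apply_fun lowerProj K m B i at ha
    rw [lowerProj_mulVec K hC, lowerProj_mulVec K hC'] at ha
    subst ha
    exact Prod.ext_iff.1 ((ofCoords K m B).injective ha')
  simp only [Matrix.mulVec_single_one] at key
  constructor
  · ext p j; exact congrFun (key j).1 p
  · ext p j; exact congrFun (key j).2 p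

/-- In coordinates the form is `((u, v), (u', v')) = J u · v' + v · J u'`. -/
theorem form_ofCoords (w z : (Fin (2 * m) → B) × (Fin (2 * m) → B)) :
    (latForm K m).baseChange B (ofCoords K m B w) (ofCoords K m B z) =
      (antiJ B m).mulVec w.1 ⬝ᵥ z.2 + w.2 ⬝ᵥ (antiJ B m).mulVec z.1 := by
  have h : ∀ (v : Fin (2 * m) → B) p, (antiJ B m).mulVec v p = -rowSign B p * v (Fin.rev p) := by
    intro v p
    rw [Matrix.mulVec, dotProduct, Finset.sum_eq_single (Fin.rev p)]
    · rw [antiJ, yTilde_apply, Matrix.one_apply_eq, mul_one]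
    · intro l _ hl
      rw [antiJ, yTilde_apply, Matrix.one_apply_ne (Ne.symm hl), mul_zero, zero_mul]
    · simp
  rw [baseChange_latForm_ofCoords, dotProduct, dotProduct]
  have h1 : ∑ p, (antiJ B m).mulVec w.1 p * z.2 p =
      ∑ p, rowSign B p * (w.1 p * z.2 (Fin.rev p)) := by
    rw [← Equiv.sum_comp Fin.revPerm]
    refine Finset.sum_congr rfl fun p _ => ?_
    simp only [Fin.revPerm_apply, h, rowSign_rev, Fin.rev_rev]
    ring
  rw [h1, ← Finset.sum_add_distrib]
  refine Finset.sum_congr rfl fun p _ => ?_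
  rw [h]
  ring

theorem form_colSpan_one (X : Matrix (Fin (2 * m)) (Fin (2 * m)) B) (a : Fin (2 * m) → B)
    (z : (Fin (2 * m) → B) × (Fin (2 * m) → B)) :
    (latForm K m).baseChange B (ofCoords K m B (X.mulVec a, a)) (ofCoords K m B z) =
      a ⬝ᵥ ((yTilde X).transpose.mulVec z.2 + (antiJ B m).mulVec z.1) := by
  rw [form_ofCoords, dotProduct_add, Matrix.mulVec_mulVec, antiJ_mul, Matrix.mulVec_transpose,
    dotProduct_comm a (Matrix.vecMul _ _), ← Matrix.dotProduct_mulVec, dotProduct_comm z.2]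

/-- If `J X` is skew, then `F_1 = {(X v, v)}` is its own orthogonal complement; the converse is
`transpose_yTilde_of_orthogonal`. -/
theorem orthogonal_colSpan_one {X : Matrix (Fin (2 * m)) (Fin (2 * m)) B}
    (hX : (yTilde X).transpose = -yTilde X) :
    ((latForm K m).baseChange B).orthogonal (colSpan K X 1) = colSpan K X 1 := by
  ext x
  obtain ⟨z, rfl⟩ := (ofCoords K m B).surjective x
  rw [ofCoords_mem_colSpan_one, LinearMap.BilinForm.mem_orthogonal_iff]
  have h1 : (yTilde X).transpose.mulVec z.2 + (antiJ B m).mulVec z.1 =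
      (antiJ B m).mulVec (z.1 - X.mulVec z.2) := by
    rw [hX, Matrix.mulVec_sub, Matrix.mulVec_mulVec, antiJ_mul, Matrix.neg_mulVec]
    abel
  constructor
  · intro h
    have h2 : (antiJ B m).mulVec (z.1 - X.mulVec z.2) = 0 := by
      rw [← h1]
      refine dotProduct_eq_zero _ fun a => ?_
      rw [dotProduct_comm, ← form_colSpan_one K]
      exact h _ ((ofCoords_mem_colSpan_one K X _).2 rfl)
    have h3 := congrArg (antiJ B m).mulVec h2
    rw [Matrix.mulVec_mulVec, antiJ_mul_antiJ, Matrix.neg_mulVec, Matrix.one_mulVec,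
      Matrix.mulVec_zero, neg_eq_zero] at h3
    exact sub_eq_zero.1 h3
  · intro h y hy
    obtain ⟨w, rfl⟩ := (ofCoords K m B).surjective y
    have hw := (ofCoords_mem_colSpan_one K X _).1 hy
    have e : w = (X.mulVec w.2, w.2) := Prod.ext hw rfl
    rw [e]
    change (latForm K m).baseChange B _ _ = 0
    rw [form_colSpan_one, h1, h, sub_self, Matrix.mulVec_zero, dotProduct_zero]

theorem transpose_yTilde_of_orthogonal {X : Matrix (Fin (2 * m)) (Fin (2 * m)) B}
    (h : ((latForm K m).baseChange B).orthogonal (colSpan K X 1) = colSpan K X 1) :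
    (yTilde X).transpose = -yTilde X := by
  rw [eq_neg_iff_add_eq_zero]
  ext p q
  have h1 : ofCoords K m B (X.mulVec (Pi.single q 1), Pi.single q 1) ∈
      ((latForm K m).baseChange B).orthogonal (colSpan K X 1) := by
    rw [h]; exact (ofCoords_mem_colSpan_one K X _).2 rfl
  have h2 := (LinearMap.BilinForm.mem_orthogonal_iff.1 h1) _
    ((ofCoords_mem_colSpan_one K X (X.mulVec (Pi.single p 1), Pi.single p 1)).2 rfl)
  change (latForm K m).baseChange B _ _ = 0 at h2
  rw [form_colSpan_one, Matrix.mulVec_mulVec, antiJ_mul, ← Matrix.add_mulVec,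
    Matrix.mulVec_single_one, single_one_dotProduct] at h2
  exact h2

end ColumnSpan

/-! ### Points of the chart over a ring -/

section ChartPoints

variable {O F₀ F : Type u}
    [CommRing O] [IsDomain O] [IsDiscreteValuationRing O] [Field F₀] [Algebra O F₀]
    [IsFractionRing O F₀] [Field F] [Algebra F₀ F] [Algebra O F] [IsScalarTower O F₀ F]
    (K : RamifiedQuadratic O F₀ F) {m s : ℕ}

variable {B : Type u} [CommRing B] [Algebra O B] [Algebra (IntRing O F) B]
    [IsScalarTower O (IntRing O F) B]

variable (B) in
/-- The image of `π` in an `O_F`-algebra. -/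
noncomputable abbrev piIn : B := algebraMap (IntRing O F) B K.π

variable (B) in
theorem algebraMap_π₀ : algebraMap O B K.π₀ = piIn K B ^ 2 := by
  rw [← map_pow, K.π_sq, ← IsScalarTower.algebraMap_apply]

/-- The point `F_0 = {(π Y a, Y a)}`, `F_1 = {(X v, v)}` with `X = -Y D Ỹᵗ - π` attached to a
chart datum. -/
noncomputable def chartPair {i : Fin s ↪ Fin (2 * m)} {D : Matrix (Fin s) (Fin s) B}
    {Y : Matrix (Fin (2 * m)) (Fin s) B} (h : IsChartDatum (piIn K B) i D Y) :
    SplittingPair K m s B where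
  F0 := colSpan K (piIn K B • Y) Y
  F1 := colSpan K (upperBlock (piIn K B) D Y) 1
  summand_F0 := ⟨_, isCompl_colSpan K h.submatrix_eq⟩
  summand_F1 := ⟨_, isCompl_colSpan_one K _⟩
  rank_F0 := rankAtStalk_colSpan K h.submatrix_eq
  rank_F1 := rankAtStalk_colSpan K (i := Function.Embedding.refl _) rfl
  le := by
    intro x hx
    obtain ⟨a, rfl⟩ := (mem_colSpan K _ _ x).1 hx
    rw [ofCoords_mem_colSpan_one, Matrix.mulVec_mulVec, h.upperBlock_mul]
  perp := orthogonal_colSpan_one K h.transpose_eq_neg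
  t_add_mem := by
    intro x hx
    obtain ⟨w, rfl⟩ := (ofCoords K m B).surjective x
    have hw := (ofCoords_mem_colSpan_one K _ w).1 hx
    have h1 : w.1 + piIn K B • w.2 =
        Y.mulVec (-(D * (yTilde Y).transpose).mulVec w.2) := by
      rw [hw, upperBlock, Matrix.sub_mulVec, Matrix.smul_mulVec, Matrix.one_mulVec,
        sub_add_cancel, Matrix.neg_mulVec, Matrix.mulVec_neg, Matrix.mulVec_mulVec,
        Matrix.mul_assoc]
    rw [tOver_ofCoords, ← map_smul, ← map_add, ofCoords_mem_colSpan]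
    refine ⟨_, ?_, h1⟩
    rw [Matrix.smul_mulVec, ← h1, algebraMap_π₀ K B]
    ext p
    simp only [Prod.fst_add, Prod.smul_fst, Pi.add_apply, Pi.smul_apply, smul_eq_mul]
    ring
  t_sub_eq_zero := by
    intro x hx
    obtain ⟨a, rfl⟩ := (mem_colSpan K _ _ x).1 hx
    rw [tOver_ofCoords, ← map_smul, ← map_sub, algebraMap_π₀ K B, Matrix.smul_mulVec]
    refine (congrArg _ ?_).trans (map_zero _)
    ext p
    · simp only [Prod.fst_sub, Prod.smul_fst, Pi.sub_apply, Pi.smul_apply, smul_eq_mul,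
        Prod.fst_zero, Pi.zero_apply]
      ring
    · simp

/-- The relation `(t - π) F_0 = 0` says that elements of `F_0` have the form `(π v, v)`. -/
theorem SplittingPair.fst_eq_smul_snd (P : SplittingPair K m s B)
    {w : (Fin (2 * m) → B) × (Fin (2 * m) → B)} (hw : ofCoords K m B w ∈ P.F0) :
    w.1 = piIn K B • w.2 := by
  have h := P.t_sub_eq_zero _ hw
  rw [tOver_ofCoords, ← map_smul, ← map_sub] at h
  have h1 := (ofCoords K m B).map_eq_zero_iff.1 h
  have h2 := congrArg Prod.snd h1
  exact sub_eq_zero.1 h2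

/-- Every point that satisfies the chart condition comes from a chart datum: `(t + π) F_1 ⊂ F_0`
says `X + π = Y Z`, `F_0 ⊂ F_1` says `X Y = π Y`, and `F_1 = F_1^⊥` says that `J X` is skew. -/
theorem SplittingPair.exists_isChartDatum (P : SplittingPair K m s B) {i : Fin s ↪ Fin (2 * m)}
    (h1 : IsCompl P.F1 (upperSpan K m B)) (h0 : IsCompl P.F0 (minorSpan K m i B)) :
    ∃ D Y, IsChartDatum (piIn K B) i D Y ∧ P.F0 = colSpan K (piIn K B • Y) Y ∧
      P.F1 = colSpan K (upperBlock (piIn K B) D Y) 1 := by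
  obtain ⟨X, hX⟩ := exists_eq_colSpan_one K h1
  obtain ⟨A, Y, hY, hAY⟩ := exists_eq_colSpan K h0
  have hA : A = piIn K B • Y := by
    ext p q
    have hq : ofCoords K m B (fun p => A p q, fun p => Y p q) ∈ P.F0 := by
      rw [hAY]; exact Submodule.subset_span ⟨q, rfl⟩
    exact congrFun (P.fst_eq_smul_snd K hq) p
  subst hA
  have hXY : X * Y = piIn K B • Y := by
    ext p q
    have hq : ofCoords K m B (fun p => (piIn K B • Y) p q, fun p => Y p q) ∈ P.F1 := by
      apply P.le; rw [hAY]; exact Submodule.subset_span ⟨q, rfl⟩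
    rw [hX, ofCoords_mem_colSpan_one] at hq
    exact (congrFun hq p).symm
  have hZ : ∀ q, ∃ z : Fin s → B, ∀ p, (X + piIn K B • 1) p q = Y.mulVec z p := by
    intro q
    have hq : ofCoords K m B (X.mulVec (Pi.single q 1), Pi.single q 1) ∈ P.F1 := by
      rw [hX, ofCoords_mem_colSpan_one]
    have h2 := P.t_add_mem _ hq
    rw [tOver_ofCoords, ← map_smul, ← map_add, hAY, ofCoords_mem_colSpan] at h2
    obtain ⟨z, -, hz⟩ := h2
    refine ⟨z, fun p => ?_⟩
    rw [← hz]
    simp only [Prod.snd_add, Prod.smul_snd, Pi.add_apply, Pi.smul_apply, Matrix.mulVec_single_one,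
      Matrix.add_apply, Matrix.smul_apply, Matrix.one_apply, Pi.single_apply]
    rfl
  choose z hz using hZ
  have hZ' : X + piIn K B • 1 = Y * (Matrix.of fun a q => z q a) := by
    ext p q
    rw [hz]
    rfl
  have hXX : (yTilde X).transpose = -yTilde X := by
    apply transpose_yTilde_of_orthogonal K
    rw [← hX, P.perp]
  obtain ⟨D, hD, hDX⟩ := NaiveSplitting.exists_isChartDatum hY hXX hXY hZ'
  exact ⟨D, Y, hD, hAY, by rw [hDX, hX]⟩

omit [IsScalarTower O (IntRing O F) B] in
/-- A chart datum is determined by the submodules that it defines. -/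
theorem IsChartDatum.ext {i : Fin s ↪ Fin (2 * m)} {D D' : Matrix (Fin s) (Fin s) B}
    {Y Y' : Matrix (Fin (2 * m)) (Fin s) B} (h : IsChartDatum (piIn K B) i D Y)
    (h' : IsChartDatum (piIn K B) i D' Y')
    (e0 : colSpan K (piIn K B • Y) Y = colSpan K (piIn K B • Y') Y')
    (e1 : colSpan K (upperBlock (piIn K B) D Y) 1 = colSpan K (upperBlock (piIn K B) D' Y') 1) :
    D = D' ∧ Y = Y' := by
  obtain rfl := (colSpan_injective K h.submatrix_eq h'.submatrix_eq e0).2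
  have hX := (colSpan_injective K (i := Function.Embedding.refl _) rfl rfl e1).1
  exact ⟨upperBlock_left_injective h.submatrix_eq hX, rfl⟩

section BaseChange

variable {C : Type u} [CommRing C] [Algebra O C] [Algebra (IntRing O F) C]

omit [IsScalarTower O (IntRing O F) B] in
theorem extend_chart_F0 (f : B →ₐ[O] C) (hf : f (piIn K B) = piIn K C)
    (Y : Matrix (Fin (2 * m)) (Fin s) B) :
    extend K m f (colSpan K (piIn K B • Y) Y) =
      colSpan K (piIn K C • Y.map f) (Y.map f) := by
  rw [extend_colSpan]
  congr 1
  ext p q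
  simp only [Matrix.map_apply, Matrix.smul_apply, smul_eq_mul, map_mul, hf]

omit [IsScalarTower O (IntRing O F) B] in
theorem extend_chart_F1 (f : B →ₐ[O] C) (hf : f (piIn K B) = piIn K C)
    (D : Matrix (Fin s) (Fin s) B) (Y : Matrix (Fin (2 * m)) (Fin s) B) :
    extend K m f (colSpan K (upperBlock (piIn K B) D Y) 1) =
      colSpan K (upperBlock (piIn K C) (D.map f) (Y.map f)) 1 := by
  rw [extend_colSpan, ← hf]
  congr 1
  · exact (upperBlock_map (f : B →+* C) _ D Y).symm
  · exact Matrix.map_one _ (map_zero f) (map_one f)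

end BaseChange

/-! ### Points over a field -/

/-- A matrix of full column rank over a field has an invertible maximal minor. -/
theorem exists_det_submatrix_ne_zero {κ : Type u} [Field κ] {n k : ℕ}
    (A : Matrix (Fin n) (Fin k) κ) (hA : LinearIndependent κ A.col) :
    ∃ i : Fin k ↪ Fin n, (A.submatrix i id).det ≠ 0 := by
  have hr : Module.finrank κ (Submodule.span κ (Set.range A.row)) = k := by
    rw [← Matrix.rank_eq_finrank_span_row, Matrix.rank_eq_finrank_span_cols]
    rw [finrank_span_eq_card hA, Fintype.card_fin]
  obtain ⟨ι, a, ha, hsp, hli⟩ := exists_linearIndependent' κ A.row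
  have : Finite ι := Finite.of_injective a ha
  have := Fintype.ofFinite ι
  have hc : Fintype.card ι = k := by
    rw [← finrank_span_eq_card hli, hsp, hr]
  let e : Fin k ≃ ι := (Fintype.equivFinOfCardEq hc).symm
  refine ⟨⟨a ∘ e, ha.comp e.injective⟩, ?_⟩
  have hli' : LinearIndependent κ (A.submatrix (a ∘ e) id).row :=
    hli.comp e e.injective
  have := Matrix.linearIndependent_rows_iff_isUnit.1 hli'
  exact ((Matrix.isUnit_iff_isUnit_det _).1 this).ne_zero

/-- Over a field, a subspace of dimension `k` has `k` vectors with an invertible minor. The field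
structure is a hypothesis because the rings of sections in use only carry a ring structure. -/
theorem exists_isUnit_det_of_isField {κ : Type u} [inst : CommRing κ] (hκ : IsField κ) {n k : ℕ}
    (W : Submodule κ (Fin n → κ)) (hW : ∀ q : PrimeSpectrum κ, Module.rankAtStalk W q = k) :
    ∃ (i : Fin k ↪ Fin n) (v : Fin k → Fin n → κ), (∀ j, v j ∈ W) ∧
      IsUnit (Matrix.of fun j => v j ∘ i).det := by
  obtain ⟨fld, hfld⟩ : ∃ f : Field κ, f.toCommRing = inst := ⟨hκ.toField, rfl⟩
  subst hfld
  have hr : Module.finrank κ W = k := by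
    have := hW ⊥
    rw [Module.rankAtStalk_eq_finrank_of_free] at this
    simpa using this
  let b := Module.finBasisOfFinrankEq κ W hr
  let A : Matrix (Fin n) (Fin k) κ := .of fun p j => (b j : Fin n → κ) p
  have hA : LinearIndependent κ A.col :=
    b.linearIndependent.map' W.subtype (Submodule.ker_subtype W)
  obtain ⟨i, hi⟩ := exists_det_submatrix_ne_zero A hA
  refine ⟨i, fun j => b j, fun j => (b j).2, ?_⟩
  have e : (Matrix.of fun j => (b j : Fin n → κ) ∘ i) = (A.submatrix i id).transpose := rfl
  rw [e, Matrix.det_transpose]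
  exact IsUnit.mk0 _ hi

/-- Over a field, `F_0` satisfies the chart condition for some choice of rows: as its elements
have the form `(π v, v)`, it projects injectively to the lower coordinates. -/
theorem SplittingPair.exists_isCompl_minorSpan (hB : IsField B) (P : SplittingPair K m s B) :
    ∃ i : Fin s ↪ Fin (2 * m), IsCompl P.F0 (minorSpan K m i B) := by
  let p2 : P.F0 →ₗ[B] (Fin (2 * m) → B) :=
    LinearMap.snd B _ _ ∘ₗ (ofCoords K m B).symm.toLinearMap ∘ₗ P.F0.subtype
  have hinj : Function.Injective p2 := by
    refine (injective_iff_map_eq_zero _).2 ?_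
    rintro ⟨x, hx⟩ h
    obtain ⟨w, rfl⟩ := (ofCoords K m B).surjective x
    have h2 : w.2 = 0 := by simpa [p2] using h
    have h1 := P.fst_eq_smul_snd K hx
    rw [h2, smul_zero] at h1
    apply Subtype.ext
    change ofCoords K m B w = 0
    rw [show w = 0 from Prod.ext h1 h2, map_zero]
  have hrank : ∀ q : PrimeSpectrum B, Module.rankAtStalk (LinearMap.range p2) q = s := by
    intro q
    rw [← Module.rankAtStalk_eq_of_equiv (R := B) (M := P.F0) (N := LinearMap.range p2)
      (LinearEquiv.ofInjective p2 hinj)]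
    exact P.rank_F0 q
  obtain ⟨i, v, hv, hd⟩ := exists_isUnit_det_of_isField hB (LinearMap.range p2) hrank
  choose w hw using hv
  refine ⟨i, (isCompl_minorSpan_iff P.summand_F0 P.rank_F0 i).2 fun q => ?_⟩
  refine ⟨fun k => w k, fun k => (w k).2, ?_⟩
  have e : (Matrix.of fun j => lowerProj K m B i (w j : LatticeOver K m B)) =
      Matrix.of fun j => v j ∘ i := by
    simp only [← hw]
    rfl
  rw [e]
  exact fun hq => q.isPrime.ne_top (Ideal.eq_top_of_isUnit_mem _ hq hd)

omit [Algebra (IntRing O F) B] [IsScalarTower O (IntRing O F) B] in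
theorem colSpan_zero_one (h0 : algebraMap O B K.π₀ = 0) :
    colSpan K (0 : Matrix (Fin (2 * m)) (Fin (2 * m)) B) 1 = LinearMap.range (tOver K m B) := by
  ext x
  obtain ⟨w, rfl⟩ := (ofCoords K m B).surjective x
  rw [ofCoords_mem_colSpan_one, Matrix.zero_mulVec]
  constructor
  · intro hw
    refine ⟨ofCoords K m B (w.2, 0), ?_⟩
    rw [tOver_ofCoords, smul_zero]
    exact congrArg _ (Prod.ext hw.symm rfl)
  · rintro ⟨y, hy⟩
    obtain ⟨z, rfl⟩ := (ofCoords K m B).surjective y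
    rw [tOver_ofCoords, h0, zero_smul, (ofCoords K m B).injective.eq_iff] at hy
    rw [← hy]

/-- If `F_1 = t Λ`, then `π₀ = 0` because `F_1` is isotropic, so that `t Λ` is the span of the
`t b_j`. -/
theorem isCompl_upperSpan_of_eq_range (hm : 0 < m) (P : SplittingPair K m s B)
    (h : P.F1 = LinearMap.range (tOver K m B)) : IsCompl P.F1 (upperSpan K m B) := by
  have hmem : ∀ w : (Fin (2 * m) → B) × (Fin (2 * m) → B),
      ofCoords K m B (algebraMap O B K.π₀ • w.2, w.1) ∈ P.F1 := by
    intro w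
    rw [h, ← tOver_ofCoords]
    exact ⟨_, rfl⟩
  have h0 : algebraMap O B K.π₀ = 0 := by
    let j : Fin (2 * m) := ⟨0, by omega⟩
    -- The pairing of the elements `π₀ b_j` and `t b_{n+1-j}` of `F_1` is `± π₀`.
    have h1 := hmem (0, Pi.single j 1)
    rw [← P.perp] at h1
    have h2 := LinearMap.BilinForm.mem_orthogonal_iff.1 h1 _ (hmem (Pi.single (Fin.rev j) 1, 0))
    change (latForm K m).baseChange B _ _ = 0 at h2
    rw [baseChange_latForm_ofCoords, Finset.sum_eq_single (Fin.rev j)] at h2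
    · simp only [Fin.rev_rev, Pi.smul_apply, Pi.single_eq_same, Pi.zero_apply, mul_zero, zero_sub,
        one_mul, smul_eq_mul, mul_one, mul_neg, neg_eq_zero] at h2
      have h3 := congrArg (rowSign B (Fin.rev j) * ·) h2
      simpa only [← mul_assoc, rowSign_mul_self, one_mul, mul_zero] using h3
    · intro k _ hk
      simp [Pi.single_eq_of_ne hk]
    · simp
  rw [h, ← colSpan_zero_one K h0]
  exact isCompl_colSpan_one K _

end ChartPoints

/-! ### Direct summands under base change -/

section Summands

variable {O F₀ F : Type u}
    [CommRing O] [IsDomain O] [IsDiscreteValuationRing O] [Field F₀] [Algebra O F₀]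
    [IsFractionRing O F₀] [Field F] [Algebra F₀ F] [Algebra O F] [IsScalarTower O F₀ F]
    {K : RamifiedQuadratic O F₀ F} {m : ℕ}
    {B C : Type u} [CommRing B] [Algebra O B] [CommRing C] [Algebra O C]

/-- An endomorphism of `Λ ⊗ B` extends to `Λ ⊗ C` along `f : B → C`. -/
theorem exists_extend_endomorphism (f : B →ₐ[O] C)
    (e : LatticeOver K m B →ₗ[B] LatticeOver K m B) :
    ∃ e' : LatticeOver K m C →ₗ[C] LatticeOver K m C, ∀ x,
      e' (TensorProduct.map f.toLinearMap (LinearMap.id : lattice K m →ₗ[O] lattice K m) x) =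
        TensorProduct.map f.toLinearMap (LinearMap.id : lattice K m →ₗ[O] lattice K m) (e x) := by
  let b := (latticeBasis K m).baseChange B
  let c := (latticeBasis K m).baseChange C
  let φ := TensorProduct.map f.toLinearMap (LinearMap.id : lattice K m →ₗ[O] lattice K m)
  have hφ : ∀ j, φ (b j) = c j := by
    intro j
    simp [φ, b, c]
  refine ⟨c.constr C fun j => φ (e (b j)), fun x => ?_⟩
  conv_lhs => rw [← b.sum_repr x]
  conv_rhs => rw [← b.sum_repr x]
  rw [map_sum, map_sum, map_sum, map_sum]
  refine Finset.sum_congr rfl fun j _ => ?_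
  rw [map_smul_map, map_smul e, map_smul_map, map_smul]
  change f _ • (c.constr C fun j => φ (e (b j))) (φ (b j)) = _
  rw [hφ, Module.Basis.constr_basis]

/-- If the image of `x` lies in the base change of a summand, then the image of its component along
the complement vanishes. -/
theorem map_projection_eq_zero (f : B →ₐ[O] C) {N G : Submodule B (LatticeOver K m B)}
    (h : IsCompl N G) {x : LatticeOver K m B}
    (hx : TensorProduct.map f.toLinearMap (LinearMap.id : lattice K m →ₗ[O] lattice K m) x ∈
      extend K m f N) :
    TensorProduct.map f.toLinearMap (LinearMap.id : lattice K m →ₗ[O] lattice K m)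
      (G.projection N h.symm x) = 0 := by
  obtain ⟨e', he'⟩ := exists_extend_endomorphism f (G.projection N h.symm)
  rw [← he']
  have hle : extend K m f N ≤ LinearMap.ker e' := by
    refine Submodule.span_le.2 ?_
    rintro _ ⟨y, hy, rfl⟩
    simp only [SetLike.mem_coe, LinearMap.mem_ker]
    rw [he', (Submodule.projection_apply_eq_zero_iff h.symm).2 hy, map_zero]
  exact hle hx

/-- Direct summands stay direct summands under `extend`, because the projections extend. -/
theorem isCompl_extend (f : B →ₐ[O] C) {N G : Submodule B (LatticeOver K m B)}
    (h : IsCompl N G) : IsCompl (extend K m f N) (extend K m f G) := by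
  constructor
  · rw [Submodule.disjoint_def]
    obtain ⟨e', he'⟩ := exists_extend_endomorphism f (N.projection G h)
    have h1 : extend K m f N ≤ LinearMap.ker (LinearMap.id - e') := by
      refine Submodule.span_le.2 ?_
      rintro _ ⟨y, hy, rfl⟩
      simp only [SetLike.mem_coe, LinearMap.mem_ker, LinearMap.sub_apply, LinearMap.id_apply]
      rw [he', Submodule.projection_apply_of_mem_left h hy, sub_self]
    have h2 : extend K m f G ≤ LinearMap.ker e' := by
      refine Submodule.span_le.2 ?_
      rintro _ ⟨y, hy, rfl⟩
      simp only [SetLike.mem_coe, LinearMap.mem_ker]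
      rw [he', (Submodule.projection_apply_eq_zero_iff h).2 hy, map_zero]
    intro x hx hx'
    have h3 := h1 hx
    rw [LinearMap.mem_ker, LinearMap.sub_apply, LinearMap.id_apply, LinearMap.mem_ker.1 (h2 hx'),
      sub_zero] at h3
    exact h3
  · rw [codisjoint_iff, eq_top_iff]
    intro y _
    rw [← ((latticeBasis K m).baseChange C).sum_repr y]
    refine Submodule.sum_mem _ fun j _ => Submodule.smul_mem _ _ ?_
    have e : ((latticeBasis K m).baseChange C) j = TensorProduct.map f.toLinearMap
        (LinearMap.id : lattice K m →ₗ[O] lattice K m) ((latticeBasis K m).baseChange B j) := by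
      simp
    obtain ⟨a, ha, b, hb, hab⟩ := Submodule.mem_sup.1
      (show (latticeBasis K m).baseChange B j ∈ N ⊔ G by rw [h.sup_eq_top]; trivial)
    rw [e, ← hab, map_add]
    exact Submodule.add_mem_sup (Submodule.subset_span ⟨a, ha, rfl⟩)
      (Submodule.subset_span ⟨b, hb, rfl⟩)

end Summands

/-! ### Rings of sections -/

section SectionRings

variable {O F : Type u} [CommRing O] [Field F] [Algebra O F]

theorem secMap_algebraMap {S T : Over (Base O F)} (g : T ⟶ S) (U : S.left.Opens)
    (V : T.left.Opens) (h : V ≤ g.left ⁻¹ᵁ U) (a : IntRing O F) :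
    secMap g U V h (algebraMap (IntRing O F) (Sec S U) a) =
      algebraMap (IntRing O F) (Sec T V) a := by
  have e : secStr S U ≫ g.left.appLE U V h = secStr T V := by
    have w : g.left ≫ str S = str T := Over.w g
    unfold secStr
    rw [Category.assoc, Scheme.Hom.appLE_comp_appLE]
    simp only [w]
  exact congrArg (fun f => f.hom a) e

theorem secMap_comp {S T T' : Over (Base O F)} (g : T ⟶ S) (g' : T' ⟶ T) (U : S.left.Opens)
    (V : T.left.Opens) (W : T'.left.Opens) (h : V ≤ g.left ⁻¹ᵁ U) (h' : W ≤ g'.left ⁻¹ᵁ V)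
    (h'' : W ≤ (g' ≫ g).left ⁻¹ᵁ U) :
    (secMap g' V W h').comp (secMap g U V h) = secMap (g' ≫ g) U W h'' := by
  ext a
  have := Scheme.Hom.appLE_comp_appLE g'.left g.left U V W h h'
  exact congrArg (fun f => f.hom a) this

/-- The prime ideal of `Γ(T, V)` at a point of the affine open `V`. -/
noncomputable def secPrime (T : Over (Base O F)) (V : T.left.affineOpens) (t : T.left)
    (ht : t ∈ V.1) : PrimeSpectrum (Sec T V.1) := V.2.primeIdealOf ⟨t, ht⟩

theorem comap_secPrime {S T : Over (Base O F)} (g : T ⟶ S) (U : S.left.affineOpens)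
    (V : T.left.affineOpens) (h : V.1 ≤ g.left ⁻¹ᵁ U.1) (t : T.left) (ht : t ∈ V.1) :
    (secPrime T V t ht).comap (secMap g U.1 V.1 h : Sec S U.1 →+* Sec T V.1) =
      secPrime S U (g.left t) (h ht) :=
  IsAffineOpen.comap_primeIdealOf_appLE U.1 U.2 V.1 V.2 h ht

theorem exists_secPrime_eq (T : Over (Base O F)) (V : T.left.affineOpens)
    (q : PrimeSpectrum (Sec T V.1)) : ∃ t ht, secPrime T V t ht = q := by
  have hV : IsAffineOpen V.1 := V.2
  have hx : hV.isoSpec.hom (hV.isoSpec.inv q) = q :=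
    congrArg (fun f : Spec Γ(T.left, V.1) ⟶ Spec Γ(T.left, V.1) => f q) hV.isoSpec.inv_hom_id
  exact ⟨(hV.isoSpec.inv q : V.1).1, (hV.isoSpec.inv q : V.1).2, hx⟩

/-- A section `a` avoids the prime ideal of `t` if and only if `t` lies in the basic open of `a`. -/
theorem notMem_secPrime_iff (T : Over (Base O F)) (V : T.left.affineOpens) (t : T.left)
    (ht : t ∈ V.1) (a : Sec T V.1) :
    a ∉ (secPrime T V t ht).asIdeal ↔ t ∈ T.left.basicOpen (U := V.1) a := by
  have h1 := V.2.fromSpec_preimage_basicOpen (f := a)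
  have h2 : V.2.primeIdealOf ⟨t, ht⟩ ∈ V.2.fromSpec ⁻¹ᵁ T.left.basicOpen (U := V.1) a ↔
      V.2.fromSpec (V.2.primeIdealOf ⟨t, ht⟩) ∈ T.left.basicOpen (U := V.1) a := Iff.rfl
  rw [V.2.fromSpec_primeIdealOf, h1] at h2
  exact h2

theorem exists_affine_nhds (T : Over (Base O F)) {U : T.left.Opens} {t : T.left} (ht : t ∈ U) :
    ∃ V : T.left.affineOpens, t ∈ V.1 ∧ V.1 ≤ U := by
  obtain ⟨W, hW, h1, h2⟩ := exists_isAffineOpen_mem_and_subset ht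
  exact ⟨⟨W, hW⟩, h1, h2⟩

theorem appLE_id (X : Scheme.{u}) (U V : X.Opens) (h : V ≤ U) :
    (𝟙 X : X ⟶ X).appLE U V h = X.presheaf.map (homOfLE h).op := by
  simp only [Scheme.Hom.appLE, Scheme.Hom.id_app]
  exact Category.id_comp _

theorem eq_zero_of_locally (T : Over (Base O F)) (V : T.left.Opens) (a : Sec T V)
    (h : ∀ t ∈ V, ∃ (W : T.left.affineOpens) (hW : W.1 ≤ V), t ∈ W.1 ∧
      secMap (𝟙 T) V W.1 hW a = 0) : a = 0 := by
  choose W hW htW ha using fun t : V => h t.1 t.2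
  refine TopCat.Sheaf.eq_of_locally_eq' T.left.sheaf (fun t => (W t).1) V
    (fun t => homOfLE (hW t)) (fun t ht => ?_) a 0 fun t => ?_
  · exact TopologicalSpace.Opens.mem_iSup.2 ⟨⟨t, ht⟩, htW ⟨t, ht⟩⟩
  · have e := appLE_id T.left V (W t).1 (hW t)
    refine ((congrArg (fun f => f.hom a) e).symm.trans (ha t)).trans ?_
    exact (map_zero (T.left.presheaf.map (homOfLE (hW t)).op).hom).symm

end SectionRings

/-! ### Pullback of families is local -/

section Families

variable {O F₀ F : Type u}
    [CommRing O] [IsDomain O] [IsDiscreteValuationRing O] [Field F₀] [Algebra O F₀]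
    [IsFractionRing O F₀] [Field F] [Algebra F₀ F] [Algebra O F] [IsScalarTower O F₀ F]
    {K : RamifiedQuadratic O F₀ F} {m s : ℕ}

theorem map_eq_zero_of_locally (T : Over (Base O F)) (V : T.left.Opens)
    (x : LatticeOver K m (Sec T V))
    (h : ∀ t ∈ V, ∃ (W : T.left.affineOpens) (hW : W.1 ≤ V), t ∈ W.1 ∧
      TensorProduct.map (secMap (𝟙 T) V W.1 hW).toLinearMap
        (LinearMap.id : lattice K m →ₗ[O] lattice K m) x = 0) : x = 0 := by
  obtain ⟨w, rfl⟩ := (ofCoords K m (Sec T V)).surjective x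
  have h' : ∀ t ∈ V, ∃ (W : T.left.affineOpens) (hW : W.1 ≤ V), t ∈ W.1 ∧
      secMap (𝟙 T) V W.1 hW ∘ w.1 = 0 ∧ secMap (𝟙 T) V W.1 hW ∘ w.2 = 0 := by
    intro t ht
    obtain ⟨W, hW, htW, h0⟩ := h t ht
    rw [map_ofCoords, (ofCoords K m (Sec T W.1)).map_eq_zero_iff] at h0
    exact ⟨W, hW, htW, congrArg Prod.fst h0, congrArg Prod.snd h0⟩
  have hw : w = 0 := by
    ext p
    · refine eq_zero_of_locally T V _ fun t ht => ?_
      obtain ⟨W, hW, htW, h1, -⟩ := h' t ht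
      exact ⟨W, hW, htW, congrFun h1 p⟩
    · refine eq_zero_of_locally T V _ fun t ht => ?_
      obtain ⟨W, hW, htW, -, h1⟩ := h' t ht
      exact ⟨W, hW, htW, congrFun h1 p⟩
  rw [hw, map_zero]

/-- A summand of `Λ ⊗ Γ(T, V)` contains every submodule that it contains locally. -/
theorem le_of_locally (T : Over (Base O F)) (V : T.left.Opens)
    {N N' : Submodule (Sec T V) (LatticeOver K m (Sec T V))} (hN' : ∃ G, IsCompl N' G)
    (h : ∀ t ∈ V, ∃ (W : T.left.affineOpens) (hW : W.1 ≤ V), t ∈ W.1 ∧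
      extend K m (secMap (𝟙 T) V W.1 hW) N ≤ extend K m (secMap (𝟙 T) V W.1 hW) N') :
    N ≤ N' := by
  obtain ⟨G, hG⟩ := hN'
  intro x hx
  rw [← Submodule.projection_apply_eq_zero_iff hG.symm]
  refine map_eq_zero_of_locally T V _ fun t ht => ?_
  obtain ⟨W, hW, htW, hle⟩ := h t ht
  exact ⟨W, hW, htW, map_projection_eq_zero _ hG (hle (Submodule.subset_span ⟨x, hx, rfl⟩))⟩

/-- Two direct summands of `Λ ⊗ Γ(T, V)` are equal if they are so locally. -/
theorem eq_of_locally (T : Over (Base O F)) (V : T.left.Opens)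
    {N N' : Submodule (Sec T V) (LatticeOver K m (Sec T V))} (hN : ∃ G, IsCompl N G)
    (hN' : ∃ G, IsCompl N' G)
    (h : ∀ t ∈ V, ∃ (W : T.left.affineOpens) (hW : W.1 ≤ V), t ∈ W.1 ∧
      extend K m (secMap (𝟙 T) V W.1 hW) N = extend K m (secMap (𝟙 T) V W.1 hW) N') :
    N = N' := by
  refine le_antisymm (le_of_locally T V hN' fun t ht => ?_) (le_of_locally T V hN fun t ht => ?_)
  · obtain ⟨W, hW, htW, e⟩ := h t ht
    exact ⟨W, hW, htW, e.le⟩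
  · obtain ⟨W, hW, htW, e⟩ := h t ht
    exact ⟨W, hW, htW, e.ge⟩

theorem extend_secMap_comp {S T T' : Over (Base O F)} (g : T ⟶ S) (g' : T' ⟶ T)
    {U : S.left.Opens} {V : T.left.Opens} {W : T'.left.Opens} (h : V ≤ g.left ⁻¹ᵁ U)
    (h' : W ≤ g'.left ⁻¹ᵁ V) (g'' : T' ⟶ S) (hg : g' ≫ g = g'') (h'' : W ≤ g''.left ⁻¹ᵁ U)
    (N : Submodule (Sec S U) (LatticeOver K m (Sec S U))) :
    extend K m (secMap g' V W h') (extend K m (secMap g U V h) N) =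
      extend K m (secMap g'' U W h'') N := by
  subst hg
  rw [extend_extend, secMap_comp]

theorem isPullbackOf_id {T : Over (Base O F)} (x : SplittingFamily K m s T) :
    IsPullbackOf (𝟙 T) x x :=
  fun U V h => ⟨x.F0_res U V h, x.F1_res U V h⟩

theorem pt_eq_of_locally {T : Over (Base O F)} (x x' : SplittingFamily K m s T)
    (h : ∀ t : T.left, ∃ V : T.left.affineOpens, t ∈ V.1 ∧
      (x.pt V).F0 = (x'.pt V).F0 ∧ (x.pt V).F1 = (x'.pt V).F1) (V : T.left.affineOpens) :
    (x.pt V).F0 = (x'.pt V).F0 ∧ (x.pt V).F1 = (x'.pt V).F1 := by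
  have h' : ∀ t ∈ V.1, ∃ (W : T.left.affineOpens) (_ : W.1 ≤ V.1), t ∈ W.1 ∧
      (x.pt W).F0 = (x'.pt W).F0 ∧ (x.pt W).F1 = (x'.pt W).F1 := by
    intro t ht
    obtain ⟨V₀, htV₀, e0, e1⟩ := h t
    obtain ⟨W, htW, hW⟩ := exists_affine_nhds T (U := V.1 ⊓ V₀.1) ⟨ht, htV₀⟩
    have hW₀ : W.1 ≤ (𝟙 T : T ⟶ T).left ⁻¹ᵁ V₀.1 := hW.trans inf_le_right
    refine ⟨W, hW.trans inf_le_left, htW, ?_, ?_⟩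
    · rw [x.F0_res V₀ W hW₀, x'.F0_res V₀ W hW₀, e0]
    · rw [x.F1_res V₀ W hW₀, x'.F1_res V₀ W hW₀, e1]
  constructor
  · refine eq_of_locally T V.1 (x.pt V).summand_F0 (x'.pt V).summand_F0 fun t ht => ?_
    obtain ⟨W, hW, htW, e0, -⟩ := h' t ht
    exact ⟨W, hW, htW, by rw [← x.F0_res V W hW, ← x'.F0_res V W hW, e0]⟩
  · refine eq_of_locally T V.1 (x.pt V).summand_F1 (x'.pt V).summand_F1 fun t ht => ?_
    obtain ⟨W, hW, htW, -, e1⟩ := h' t ht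
    exact ⟨W, hW, htW, by rw [← x.F1_res V W hW, ← x'.F1_res V W hW, e1]⟩

/-- It suffices to check `x = g^* y` for one pair of affine opens around each point of `T`: by
`eq_of_locally`, the submodules over other affine opens are determined by their restrictions. -/
theorem isPullbackOf_of_locally {S T : Over (Base O F)} (g : T ⟶ S) (y : SplittingFamily K m s S)
    (x : SplittingFamily K m s T)
    (h : ∀ t : T.left, ∃ (U : S.left.affineOpens) (V : T.left.affineOpens)
      (hUV : V.1 ≤ g.left ⁻¹ᵁ U.1), t ∈ V.1 ∧
      (x.pt V).F0 = extend K m (secMap g U.1 V.1 hUV) (y.pt U).F0 ∧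
      (x.pt V).F1 = extend K m (secMap g U.1 V.1 hUV) (y.pt U).F1) : IsPullbackOf g y x := by
  intro U V hUV
  have h' : ∀ t ∈ V.1, ∃ (W : T.left.affineOpens) (hW : W.1 ≤ V.1), t ∈ W.1 ∧
      extend K m (secMap (𝟙 T) V.1 W.1 hW) (x.pt V).F0 = extend K m (secMap (𝟙 T) V.1 W.1 hW)
        (extend K m (secMap g U.1 V.1 hUV) (y.pt U).F0) ∧
      extend K m (secMap (𝟙 T) V.1 W.1 hW) (x.pt V).F1 = extend K m (secMap (𝟙 T) V.1 W.1 hW)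
        (extend K m (secMap g U.1 V.1 hUV) (y.pt U).F1) := by
    intro t ht
    obtain ⟨U₀, V₀, hUV₀, htV₀, e0, e1⟩ := h t
    obtain ⟨U₁, htU₁, hU₁⟩ := exists_affine_nhds S (U := U.1 ⊓ U₀.1) (t := g.left t)
      ⟨hUV ht, hUV₀ htV₀⟩
    obtain ⟨W, htW, hW⟩ := exists_affine_nhds T (U := (V.1 ⊓ V₀.1) ⊓ g.left ⁻¹ᵁ U₁.1) (t := t)
      ⟨⟨ht, htV₀⟩, htU₁⟩
    have hWV : W.1 ≤ (𝟙 T : T ⟶ T).left ⁻¹ᵁ V.1 := hW.trans (inf_le_left.trans inf_le_left)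
    have hWV₀ : W.1 ≤ (𝟙 T : T ⟶ T).left ⁻¹ᵁ V₀.1 := hW.trans (inf_le_left.trans inf_le_right)
    have hWU₁ : W.1 ≤ g.left ⁻¹ᵁ U₁.1 := hW.trans inf_le_right
    have hWU : W.1 ≤ g.left ⁻¹ᵁ U.1 := fun p hp => hUV (hWV hp)
    have hWU₀ : W.1 ≤ g.left ⁻¹ᵁ U₀.1 := fun p hp => hUV₀ (hWV₀ hp)
    have hU : U₁.1 ≤ (𝟙 S : S ⟶ S).left ⁻¹ᵁ U.1 := hU₁.trans inf_le_left
    have hU₀ : U₁.1 ≤ (𝟙 S : S ⟶ S).left ⁻¹ᵁ U₀.1 := hU₁.trans inf_le_right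
    refine ⟨W, hWV, htW, ?_, ?_⟩
    · rw [← x.F0_res V W hWV, extend_secMap_comp g (𝟙 T) hUV hWV g (Category.id_comp g) hWU,
        x.F0_res V₀ W hWV₀, e0,
        extend_secMap_comp g (𝟙 T) hUV₀ hWV₀ g (Category.id_comp g) hWU₀,
        ← extend_secMap_comp (𝟙 S) g hU₀ hWU₁ g (Category.comp_id g) hWU₀,
        ← extend_secMap_comp (𝟙 S) g hU hWU₁ g (Category.comp_id g) hWU,
        ← y.F0_res, ← y.F0_res]
    · rw [← x.F1_res V W hWV, extend_secMap_comp g (𝟙 T) hUV hWV g (Category.id_comp g) hWU,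
        x.F1_res V₀ W hWV₀, e1,
        extend_secMap_comp g (𝟙 T) hUV₀ hWV₀ g (Category.id_comp g) hWU₀,
        ← extend_secMap_comp (𝟙 S) g hU₀ hWU₁ g (Category.comp_id g) hWU₀,
        ← extend_secMap_comp (𝟙 S) g hU hWU₁ g (Category.comp_id g) hWU,
        ← y.F1_res, ← y.F1_res]
  constructor
  · obtain ⟨G, hG⟩ := (y.pt U).summand_F0
    refine eq_of_locally T V.1 (x.pt V).summand_F0 ⟨_, isCompl_extend _ hG⟩ fun t ht => ?_
    obtain ⟨W, hW, htW, e0, -⟩ := h' t ht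
    exact ⟨W, hW, htW, e0⟩
  · obtain ⟨G, hG⟩ := (y.pt U).summand_F1
    refine eq_of_locally T V.1 (x.pt V).summand_F1 ⟨_, isCompl_extend _ hG⟩ fun t ht => ?_
    obtain ⟨W, hW, htW, -, e1⟩ := h' t ht
    exact ⟨W, hW, htW, e1⟩

/-- Pullback is transitive. The affine open `W` of `T'` need not map into an affine open of `T`,
which is why locality is needed. -/
theorem IsPullbackOf.comp {S T T' : Over (Base O F)} {g : T ⟶ S} {g' : T' ⟶ T}
    {y : SplittingFamily K m s S} {x : SplittingFamily K m s T} {x' : SplittingFamily K m s T'}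
    (h : IsPullbackOf g y x) (h' : IsPullbackOf g' x x') : IsPullbackOf (g' ≫ g) y x' := by
  refine isPullbackOf_of_locally _ _ _ fun t => ?_
  obtain ⟨U, hU, -⟩ := exists_affine_nhds S (U := ⊤) (t := (g' ≫ g).left t) trivial
  obtain ⟨V, hV, hVU⟩ := exists_affine_nhds T (U := g.left ⁻¹ᵁ U.1) (t := g'.left t) hU
  obtain ⟨W, hW, hWV⟩ := exists_affine_nhds T' (U := g'.left ⁻¹ᵁ V.1) (t := t) hV
  have hWU : W.1 ≤ (g' ≫ g).left ⁻¹ᵁ U.1 := fun p hp => hVU (hWV hp)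
  refine ⟨U, W, hWU, hW, ?_, ?_⟩
  · rw [(h' V W hWV).1, (h U V hVU).1, extend_secMap_comp g g' hVU hWV _ rfl hWU]
  · rw [(h' V W hWV).2, (h U V hVU).2, extend_secMap_comp g g' hVU hWV _ rfl hWU]

theorem IsPullbackOf.unique {S T : Over (Base O F)} {g : T ⟶ S}
    {y : SplittingFamily K m s S} {x x' : SplittingFamily K m s T}
    (h : IsPullbackOf g y x) (h' : IsPullbackOf g y x') (V : T.left.affineOpens) :
    (x.pt V).F0 = (x'.pt V).F0 ∧ (x.pt V).F1 = (x'.pt V).F1 := by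
  refine pt_eq_of_locally x x' (fun t => ?_) V
  obtain ⟨U, hU, -⟩ := exists_affine_nhds S (U := ⊤) (t := g.left t) trivial
  obtain ⟨V, hV, hVU⟩ := exists_affine_nhds T (U := g.left ⁻¹ᵁ U.1) (t := t) hU
  refine ⟨V, hV, ?_, ?_⟩
  · rw [(h U V hVU).1, (h' U V hVU).1]
  · rw [(h U V hVU).2, (h' U V hVU).2]

/-! ### The locus of the chart -/

/-- The chart condition at the point `t`, expressed by minors over an affine open `V` that
contains it. It does not depend on `V`, by `inChartAt_congr`. -/
def InChartAt (i : Fin s ↪ Fin (2 * m)) {T : Over (Base O F)} (x : SplittingFamily K m s T)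
    (V : T.left.affineOpens) (t : T.left) (ht : t ∈ V.1) : Prop :=
  MinorAt K m (Function.Embedding.refl (Fin (2 * m))) (x.pt V).F1 (secPrime T V t ht) ∧
    MinorAt K m i (x.pt V).F0 (secPrime T V t ht)

theorem IsPullbackOf.inChartAt_iff {S T : Over (Base O F)} {g : T ⟶ S}
    {y : SplittingFamily K m s S} {x : SplittingFamily K m s T} (h : IsPullbackOf g y x)
    (i : Fin s ↪ Fin (2 * m)) (U : S.left.affineOpens) (V : T.left.affineOpens)
    (hUV : V.1 ≤ g.left ⁻¹ᵁ U.1) (t : T.left) (ht : t ∈ V.1) :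
    InChartAt i x V t ht ↔ InChartAt i y U (g.left t) (hUV ht) := by
  unfold InChartAt
  rw [(h U V hUV).1, (h U V hUV).2, minorAt_extend_iff, minorAt_extend_iff,
    comap_secPrime g U V hUV]

theorem inChartAt_congr {T : Over (Base O F)} (i : Fin s ↪ Fin (2 * m))
    (x : SplittingFamily K m s T) (V V' : T.left.affineOpens) (t : T.left) (ht : t ∈ V.1)
    (ht' : t ∈ V'.1) : InChartAt i x V t ht ↔ InChartAt i x V' t ht' := by
  obtain ⟨W, htW, hW⟩ := exists_affine_nhds T (U := V.1 ⊓ V'.1) ⟨ht, ht'⟩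
  exact ((isPullbackOf_id x).inChartAt_iff i V W (hW.trans inf_le_left) t htW).symm.trans
    ((isPullbackOf_id x).inChartAt_iff i V' W (hW.trans inf_le_right) t htW)

theorem isCompl_iff_inChartAt {T : Over (Base O F)} (i : Fin s ↪ Fin (2 * m))
    (x : SplittingFamily K m s T) (V : T.left.affineOpens) :
    (IsCompl (x.pt V).F1 (upperSpan K m (Sec T V.1)) ∧
      IsCompl (x.pt V).F0 (minorSpan K m i (Sec T V.1))) ↔ ∀ t ht, InChartAt i x V t ht := by
  rw [← minorSpan_refl, isCompl_minorSpan_iff (x.pt V).summand_F1 (x.pt V).rank_F1,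
    isCompl_minorSpan_iff (x.pt V).summand_F0 (x.pt V).rank_F0]
  constructor
  · exact fun h t ht => ⟨h.1 _, h.2 _⟩
  · intro h
    constructor
    · intro q
      obtain ⟨t, ht, rfl⟩ := exists_secPrime_eq T V q
      exact (h t ht).1
    · intro q
      obtain ⟨t, ht, rfl⟩ := exists_secPrime_eq T V q
      exact (h t ht).2

/-- The set of points at which the chart condition holds. -/
def chartLocus (i : Fin s ↪ Fin (2 * m)) {T : Over (Base O F)} (x : SplittingFamily K m s T) :
    Set T.left :=
  {t | ∃ V ht, InChartAt i x V t ht}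

theorem mem_chartLocus_iff {T : Over (Base O F)} (i : Fin s ↪ Fin (2 * m))
    (x : SplittingFamily K m s T) (V : T.left.affineOpens) (t : T.left) (ht : t ∈ V.1) :
    t ∈ chartLocus i x ↔ InChartAt i x V t ht :=
  ⟨fun ⟨V', ht', h⟩ => (inChartAt_congr i x V' V t ht' ht).1 h, fun h => ⟨V, ht, h⟩⟩

theorem inChart_iff {T : Over (Base O F)} (i : Fin s ↪ Fin (2 * m))
    (x : SplittingFamily K m s T) : InChart i x ↔ ∀ t, t ∈ chartLocus i x := by
  constructor
  · intro h t
    obtain ⟨V, ht, -⟩ := exists_affine_nhds T (U := ⊤) (t := t) trivial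
    exact ⟨V, ht, (isCompl_iff_inChartAt i x V).1 (h V) t ht⟩
  · intro h V
    exact (isCompl_iff_inChartAt i x V).2 fun t ht => (mem_chartLocus_iff i x V t ht).1 (h t)

theorem IsPullbackOf.mem_chartLocus_iff {S T : Over (Base O F)} {g : T ⟶ S}
    {y : SplittingFamily K m s S} {x : SplittingFamily K m s T} (h : IsPullbackOf g y x)
    (i : Fin s ↪ Fin (2 * m)) (t : T.left) :
    t ∈ chartLocus i x ↔ g.left t ∈ chartLocus i y := by
  obtain ⟨U, hU, -⟩ := exists_affine_nhds S (U := ⊤) (t := g.left t) trivial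
  obtain ⟨V, hV, hVU⟩ := exists_affine_nhds T (U := g.left ⁻¹ᵁ U.1) (t := t) hU
  rw [NaiveSplitting.mem_chartLocus_iff i x V t hV, NaiveSplitting.mem_chartLocus_iff i y U _ hU]
  exact h.inChartAt_iff i U V hVU t hV

/-- At a point of the locus, two minors are invertible; they remain so on the intersection of
their basic opens. -/
theorem isOpen_chartLocus {T : Over (Base O F)} (i : Fin s ↪ Fin (2 * m))
    (x : SplittingFamily K m s T) : IsOpen (chartLocus i x) := by
  rw [isOpen_iff_forall_mem_open]
  rintro t ⟨V, ht, ⟨v, hv, hd⟩, ⟨v', hv', hd'⟩⟩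
  rw [notMem_secPrime_iff] at hd hd'
  refine ⟨_, ?_, ((T.left.basicOpen _).isOpen.inter (T.left.basicOpen _).isOpen), ⟨hd, hd'⟩⟩
  rintro t' ⟨h1, h2⟩
  have ht' : t' ∈ V.1 := T.left.basicOpen_le _ h1
  exact ⟨V, ht', ⟨v, hv, (notMem_secPrime_iff T V t' ht' _).2 h1⟩,
    ⟨v', hv', (notMem_secPrime_iff T V t' ht' _).2 h2⟩⟩

end Families

/-! ### The universal property of the chart ring -/

section ChartRing

variable {A : Type u} [CommRing A] {m s : ℕ} (ϖ : A) (i : Fin s ↪ Fin (2 * m))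

/-- The image of the generic matrix `D` in the chart ring. -/
noncomputable def univD : Matrix (Fin s) (Fin s) (ChartRing ϖ i) :=
  (matD A m s).map (Ideal.Quotient.mk (chartIdeal ϖ i))

/-- The image of the generic matrix `Y` in the chart ring. -/
noncomputable def univY : Matrix (Fin (2 * m)) (Fin s) (ChartRing ϖ i) :=
  (matY A m s).map (Ideal.Quotient.mk (chartIdeal ϖ i))

theorem isChartDatum_univ :
    IsChartDatum (algebraMap A (ChartRing ϖ i) ϖ) i (univD ϖ i) (univY ϖ i) := by
  have h : ∀ {a b : ℕ} (M : Matrix (Fin a) (Fin b) (PolyDY A m s)),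
      entries M ⊆ chartIdeal ϖ i → M.map (Ideal.Quotient.mk (chartIdeal ϖ i)) = 0 := by
    intro a b M hM
    ext p q
    exact Ideal.Quotient.eq_zero_iff_mem.2 (hM ⟨p, q, rfl⟩)
  have hsub : ∀ {M : Set (PolyDY A m s)},
      M ⊆ (entries ((matY A m s).submatrix i id - 1) ∪
        entries (matD A m s + (matD A m s).transpose) ∪
        entries (matD A m s * ((yTilde (matY A m s)).transpose * matY A m s) +
          (2 * MvPolynomial.C ϖ : PolyDY A m s) •
            (1 : Matrix (Fin s) (Fin s) (PolyDY A m s)))) → M ⊆ chartIdeal ϖ i :=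
    fun hM => hM.trans Ideal.subset_span
  set f := Ideal.Quotient.mk (chartIdeal ϖ i)
  refine ⟨?_, ?_, ?_⟩
  · have := h _ (hsub (Set.subset_union_left.trans Set.subset_union_left))
    rw [Matrix.map_sub _ (map_sub f), Matrix.map_one _ (map_zero f) (map_one f), sub_eq_zero]
      at this
    exact this
  · have := h _ (hsub (Set.subset_union_right.trans Set.subset_union_left))
    rw [Matrix.map_add _ (map_add f), Matrix.transpose_map] at this
    exact this
  · have := h _ (hsub Set.subset_union_right)
    simp only [Matrix.map_add _ (map_add f), Matrix.map_mul, map_smul_one, map_mul, map_ofNat,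
      Matrix.transpose_map, ← yTilde_map] at this
    exact this

variable {ϖ i} {B : Type u} [CommRing B]

/-- A chart datum over an `A`-algebra `B` (with structure map `ψ`) gives a homomorphism from the
chart ring to `B`; it is unique by `chartRing_hom_ext`. -/
theorem exists_chartRing_lift (ψ : A →+* B) {D : Matrix (Fin s) (Fin s) B}
    {Y : Matrix (Fin (2 * m)) (Fin s) B} (h : IsChartDatum (ψ ϖ) i D Y) :
    ∃ φ : ChartRing ϖ i →+* B, φ.comp (algebraMap A (ChartRing ϖ i)) = ψ ∧
      (univD ϖ i).map φ = D ∧ (univY ϖ i).map φ = Y := by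
  let f : PolyDY A m s →+* B :=
    MvPolynomial.eval₂Hom ψ (Sum.elim (fun pq => D pq.1 pq.2) (fun pq => Y pq.1 pq.2))
  have hD : (matD A m s).map f = D := by
    ext p q; simp [matD, f]
  have hY : (matY A m s).map f = Y := by
    ext p q; simp [matY, f]
  have hC : ∀ a, f (MvPolynomial.C a) = ψ a := fun a => by simp [f]
  have h0 : ∀ {a b : ℕ} (M : Matrix (Fin a) (Fin b) (PolyDY A m s)), M.map f = 0 →
      ∀ c ∈ entries M, f c = 0 := by
    rintro a b M hM _ ⟨p, q, rfl⟩
    exact congrFun (congrFun hM p) q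
  have hI : ∀ c ∈ chartIdeal ϖ i, f c = 0 := by
    have hle : chartIdeal ϖ i ≤ RingHom.ker f := by
      refine Ideal.span_le.2 ?_
      rintro c ((hc | hc) | hc)
      · refine h0 _ ?_ c hc
        rw [Matrix.map_sub _ (map_sub f), Matrix.map_one _ (map_zero f) (map_one f), sub_eq_zero,
          ← h.submatrix_eq, ← hY]
        rfl
      · refine h0 _ ?_ c hc
        rw [Matrix.map_add _ (map_add f), Matrix.transpose_map, hD, h.skew]
      · refine h0 _ ?_ c hc
        simp only [Matrix.map_add _ (map_add f), Matrix.map_mul, map_smul_one, map_mul, map_ofNat,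
          Matrix.transpose_map, ← yTilde_map, hD, hY, hC]
        exact h.mul_eq
    exact hle
  refine ⟨Ideal.Quotient.lift _ f hI, ?_, ?_, ?_⟩
  · ext a
    exact hC a
  · rw [← hD]
    rfl
  · rw [← hY]
    rfl

theorem chartRing_hom_ext {φ φ' : ChartRing ϖ i →+* B}
    (hA : φ.comp (algebraMap A (ChartRing ϖ i)) = φ'.comp (algebraMap A (ChartRing ϖ i)))
    (hD : (univD ϖ i).map φ = (univD ϖ i).map φ') (hY : (univY ϖ i).map φ = (univY ϖ i).map φ') :
    φ = φ' := by
  refine Ideal.Quotient.ringHom_ext (MvPolynomial.ringHom_ext (fun a => ?_) ?_)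
  · exact congrArg (fun f => f a) hA
  · rintro (⟨p, q⟩ | ⟨p, q⟩)
    · exact congrFun (congrFun hD p) q
    · exact congrFun (congrFun hY p) q

end ChartRing

/-! ### Morphisms to affine schemes -/

section AffineTargets

/-- A morphism to `Spec R`, restricted to an open `V`, is given by the ring homomorphism
`R → Γ(X, V)`. -/
theorem toSpecΓ_map_appLE {X : Scheme.{u}} {R : CommRingCat.{u}} (f : X ⟶ Spec R) (V : X.Opens)
    (e : V ≤ f ⁻¹ᵁ ⊤) :
    V.toSpecΓ ≫ Spec.map ((Scheme.ΓSpecIso R).inv ≫ f.appLE ⊤ V e) = V.ι ≫ f := by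
  rw [Spec.map_comp, Scheme.Opens.toSpecΓ_SpecMap_appLE_assoc, Scheme.Opens.toSpecΓ_top,
    Category.assoc, toSpecΓ_SpecMap_ΓSpecIso_inv, Category.comp_id, Scheme.Hom.resLE_comp_ι]

theorem appLE_eq_of_toSpecΓ {X : Scheme.{u}} {R : CommRingCat.{u}} (f : X ⟶ Spec R) {V : X.Opens}
    (hV : IsAffineOpen V) (e : V ≤ f ⁻¹ᵁ ⊤) (φ : R ⟶ Γ(X, V))
    (h : V.ι ≫ f = V.toSpecΓ ≫ Spec.map φ) : (Scheme.ΓSpecIso R).inv ≫ f.appLE ⊤ V e = φ := by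
  apply Spec.map_injective
  rw [← toSpecΓ_map_appLE f V e, ← hV.isoSpec_hom] at h
  exact (cancel_epi _).1 h

theorem comp_appLE_eq {X : Scheme.{u}} {R S : CommRingCat.{u}} (φ : S ⟶ R) (f : X ⟶ Spec R)
    (f' : X ⟶ Spec S) (w : f ≫ Spec.map φ = f') (V : X.Opens) (e : V ≤ f ⁻¹ᵁ ⊤)
    (e' : V ≤ f' ⁻¹ᵁ ⊤) : φ ≫ (Scheme.ΓSpecIso R).inv ≫ f.appLE ⊤ V e =
      (Scheme.ΓSpecIso S).inv ≫ f'.appLE ⊤ V e' := by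
  subst w
  rw [Scheme.ΓSpecIso_inv_naturality_assoc, Scheme.Hom.comp_appLE]
  congr 1

end AffineTargets

section ChartScheme

variable {O F₀ F : Type u}
    [CommRing O] [IsDomain O] [IsDiscreteValuationRing O] [Field F₀] [Algebra O F₀]
    [IsFractionRing O F₀] [Field F] [Algebra F₀ F] [Algebra O F] [IsScalarTower O F₀ F]
    {K : RamifiedQuadratic O F₀ F} {m s : ℕ} {i : Fin s ↪ Fin (2 * m)}

/-- The homomorphism `O_F[D, Y] / I → Γ(T, V)` attached to a morphism from `T` to the chart. -/
noncomputable def coordMap {T : Over (Base O F)} (h : T ⟶ chartScheme K.π i) (V : T.left.Opens) :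
    ChartRing K.π i →+* Sec T V :=
  ((Scheme.ΓSpecIso (CommRingCat.of (ChartRing K.π i))).inv ≫
    h.left.appLE ⊤ V (fun _ _ => trivial)).hom

theorem coordMap_comp_algebraMap {T : Over (Base O F)} (h : T ⟶ chartScheme K.π i)
    (V : T.left.Opens) :
    (coordMap h V).comp (algebraMap (IntRing O F) (ChartRing K.π i)) =
      algebraMap (IntRing O F) (Sec T V) := by
  have w : h.left ≫ str (chartScheme K.π i) = str T := Over.w h
  exact congrArg CommRingCat.Hom.hom (comp_appLE_eq (R := CommRingCat.of (ChartRing K.π i))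
    (CommRingCat.ofHom (algebraMap (IntRing O F) (ChartRing K.π i))) h.left (str T) w V
    (fun _ _ => trivial) (fun _ _ => trivial))

theorem secMap_comp_coordMap {T T' : Over (Base O F)} (h : T ⟶ chartScheme K.π i) (g : T' ⟶ T)
    (h' : T' ⟶ chartScheme K.π i) (e : g ≫ h = h')
    (V : T.left.Opens) (V' : T'.left.Opens) (hV : V' ≤ g.left ⁻¹ᵁ V) :
    (secMap g V V' hV : Sec T V →+* Sec T' V').comp (coordMap h V) = coordMap h' V' := by
  subst e
  have e1 := Scheme.Hom.appLE_comp_appLE g.left h.left ⊤ V V' (fun _ _ => trivial) hV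
  exact congrArg (fun f => CommRingCat.Hom.hom
    ((Scheme.ΓSpecIso (CommRingCat.of (ChartRing K.π i))).inv ≫ f)) e1

theorem hom_ext_of_coordMap {T : Over (Base O F)} {h h' : T ⟶ chartScheme K.π i}
    (H : ∀ t : T.left, ∃ V : T.left.affineOpens, t ∈ V.1 ∧ coordMap h V.1 = coordMap h' V.1) :
    h = h' := by
  apply Over.OverMorphism.ext
  choose V hV hc using H
  refine (T.left.openCoverOfIsOpenCover (fun t => (V t).1) ?_).hom_ext _ _ fun t => ?_
  · exact TopologicalSpace.Opens.ext (Set.eq_univ_of_forall fun t =>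
      TopologicalSpace.Opens.mem_iSup.2 ⟨t, hV t⟩)
  · have e : ∀ h : T ⟶ chartScheme K.π i, (V t).1.ι ≫ h.left =
        (V t).1.toSpecΓ ≫ Spec.map (CommRingCat.ofHom (coordMap h (V t).1)) :=
      fun h => (toSpecΓ_map_appLE (R := CommRingCat.of (ChartRing K.π i)) h.left (V t).1
        (fun _ _ => trivial)).symm
    exact (e h).trans ((congrArg (fun φ => (V t).1.toSpecΓ ≫ Spec.map (CommRingCat.ofHom φ))
      (hc t)).trans (e h').symm)

/-- Compatible homomorphisms from the chart ring to the rings `Γ(T, V)` glue to a morphism from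
`T` to the chart. -/
theorem exists_hom_of_coordMaps {T : Over (Base O F)}
    (φ : ∀ V : T.left.affineOpens, ChartRing K.π i →+* Sec T V.1)
    (hφ : ∀ V, (φ V).comp (algebraMap (IntRing O F) (ChartRing K.π i)) =
      algebraMap (IntRing O F) (Sec T V.1))
    (hres : ∀ (V W : T.left.affineOpens) (hW : W.1 ≤ (𝟙 T : T ⟶ T).left ⁻¹ᵁ V.1),
      (secMap (𝟙 T) V.1 W.1 hW : Sec T V.1 →+* Sec T W.1).comp (φ V) = φ W) :
    ∃ h : T ⟶ chartScheme K.π i, ∀ V : T.left.affineOpens, coordMap h V.1 = φ V := by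
  let φ' : ∀ V : T.left.affineOpens, CommRingCat.of (ChartRing K.π i) ⟶ Γ(T.left, V.1) :=
    fun V => CommRingCat.ofHom (φ V)
  let g : ∀ V : T.left.directedAffineCover.I₀, T.left.directedAffineCover.X V ⟶
      (chartScheme K.π i).left := fun V => V.1.toSpecΓ ≫ Spec.map (φ' V)
  have hle : ∀ (V W : T.left.affineOpens) (hVW : V.1 ≤ W.1),
      T.left.homOfLE hVW ≫ W.1.toSpecΓ ≫ Spec.map (φ' W) = V.1.toSpecΓ ≫ Spec.map (φ' V) := by
    intro V W hVW
    have e2 : φ' W ≫ T.left.presheaf.map (homOfLE hVW).op = φ' V := by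
      rw [← appLE_id T.left W.1 V.1 hVW]
      exact congrArg CommRingCat.ofHom (hres W V hVW)
    rw [← e2, Spec.map_comp, Scheme.Opens.toSpecΓ_SpecMap_presheaf_map_assoc]
  have hg : ∀ {V W : T.left.directedAffineCover.I₀} (hVW : V ⟶ W),
      T.left.directedAffineCover.trans hVW ≫ g W = g V := by
    intro V W hVW
    have e1 : T.left.directedAffineCover.trans hVW = T.left.homOfLE (leOfHom hVW) :=
      Scheme.directedAffineCover_trans (leOfHom hVW)
    exact (congrArg (· ≫ g W) e1).trans (hle V W (leOfHom hVW))
  have hw : ∀ V, g V ≫ (chartScheme K.π i).hom = T.left.directedAffineCover.f V ≫ T.hom := by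
    intro V
    have e1 : CommRingCat.ofHom (algebraMap (IntRing O F) (ChartRing K.π i)) ≫ φ' V =
        secStr T V.1 := congrArg CommRingCat.ofHom (hφ V)
    change (V.1.toSpecΓ ≫ Spec.map (φ' V)) ≫
      Spec.map (CommRingCat.ofHom (algebraMap (IntRing O F) (ChartRing K.π i))) = V.1.ι ≫ T.hom
    rw [Category.assoc, ← Spec.map_comp, e1]
    exact toSpecΓ_map_appLE T.hom V.1 _
  refine ⟨T.left.directedAffineCover.glueMorphismsOverOfLocallyDirected g hg hw, fun V => ?_⟩
  have e := Scheme.OpenCover.map_glueMorphismsOverOfLocallyDirected_left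
    T.left.directedAffineCover g hg hw V
  exact congrArg CommRingCat.Hom.hom (appLE_eq_of_toSpecΓ _ V.2 (fun _ _ => trivial) (φ' V) e)

end ChartScheme

/-! ### Representability of the chart -/

section ChartFamily

variable {O F₀ F : Type u}
    [CommRing O] [IsDomain O] [IsDiscreteValuationRing O] [Field F₀] [Algebra O F₀]
    [IsFractionRing O F₀] [Field F] [Algebra F₀ F] [Algebra O F] [IsScalarTower O F₀ F]
    {K : RamifiedQuadratic O F₀ F} {m s : ℕ} {i : Fin s ↪ Fin (2 * m)}

theorem isChartDatum_coordMap {T : Over (Base O F)} (h : T ⟶ chartScheme K.π i)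
    (V : T.left.Opens) : IsChartDatum (piIn K (Sec T V)) i ((univD K.π i).map (coordMap h V))
      ((univY K.π i).map (coordMap h V)) := by
  have h1 := (isChartDatum_univ K.π i).map (coordMap h V)
  have h2 : coordMap h V (algebraMap (IntRing O F) (ChartRing K.π i) K.π) = piIn K (Sec T V) :=
    congrArg (fun f => f K.π) (coordMap_comp_algebraMap h V)
  rwa [h2] at h1

theorem chartPair_pullback {T T' : Over (Base O F)} (h : T ⟶ chartScheme K.π i) (g : T' ⟶ T)
    (h' : T' ⟶ chartScheme K.π i) (e : g ≫ h = h') (V : T.left.Opens) (V' : T'.left.Opens)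
    (hV : V' ≤ g.left ⁻¹ᵁ V) :
    (chartPair K (isChartDatum_coordMap h' V')).F0 =
      extend K m (secMap g V V' hV) (chartPair K (isChartDatum_coordMap h V)).F0 ∧
    (chartPair K (isChartDatum_coordMap h' V')).F1 =
      extend K m (secMap g V V' hV) (chartPair K (isChartDatum_coordMap h V)).F1 := by
  have hπ := secMap_algebraMap g V V' hV K.π
  have hc := secMap_comp_coordMap h g h' e V V' hV
  simp only [chartPair]
  rw [extend_chart_F0 K _ hπ, extend_chart_F1 K _ hπ, ← hc]
  exact ⟨rfl, rfl⟩

/-- The family of points of the splitting model attached to a morphism to the chart. -/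
noncomputable def chartFamily {T : Over (Base O F)} (h : T ⟶ chartScheme K.π i) :
    SplittingFamily K m s T where
  pt V := chartPair K (isChartDatum_coordMap h V.1)
  F0_res U V hV := (chartPair_pullback h (𝟙 T) h (Category.id_comp h) U.1 V.1 hV).1
  F1_res U V hV := (chartPair_pullback h (𝟙 T) h (Category.id_comp h) U.1 V.1 hV).2

theorem isPullbackOf_chartFamily {T T' : Over (Base O F)} (h : T ⟶ chartScheme K.π i)
    (g : T' ⟶ T) : IsPullbackOf g (chartFamily h) (chartFamily (g ≫ h)) :=
  fun U V hV => chartPair_pullback h g _ rfl U.1 V.1 hV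

theorem inChart_chartFamily {T : Over (Base O F)} (h : T ⟶ chartScheme K.π i) :
    InChart i (chartFamily h) :=
  fun V => ⟨isCompl_colSpan_one K _,
    isCompl_colSpan K (isChartDatum_coordMap h V.1).submatrix_eq⟩

theorem chartFamily_injective {T : Over (Base O F)} {h h' : T ⟶ chartScheme K.π i}
    (H : ∀ V : T.left.affineOpens, ((chartFamily h).pt V).F0 = ((chartFamily h').pt V).F0 ∧
      ((chartFamily h).pt V).F1 = ((chartFamily h').pt V).F1) : h = h' := by
  apply hom_ext_of_coordMap
  intro t
  obtain ⟨V, ht, -⟩ := exists_affine_nhds T (U := ⊤) (t := t) trivial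
  refine ⟨V, ht, ?_⟩
  obtain ⟨hD, hY⟩ := (isChartDatum_coordMap h V.1).ext K (isChartDatum_coordMap h' V.1)
    (H V).1 (H V).2
  refine chartRing_hom_ext ?_ hD hY
  rw [coordMap_comp_algebraMap, coordMap_comp_algebraMap]

theorem IsChartDatum.map_secMap {S T : Over (Base O F)} (g : T ⟶ S) {U : S.left.Opens}
    {V : T.left.Opens} (h : V ≤ g.left ⁻¹ᵁ U) {D : Matrix (Fin s) (Fin s) (Sec S U)}
    {Y : Matrix (Fin (2 * m)) (Fin s) (Sec S U)} (hDY : IsChartDatum (piIn K (Sec S U)) i D Y) :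
    IsChartDatum (piIn K (Sec T V)) i (D.map (secMap g U V h)) (Y.map (secMap g U V h)) := by
  have hmap := hDY.map (secMap g U V h : Sec S U →+* Sec T V)
  have hπ : (secMap g U V h : Sec S U →+* Sec T V) (piIn K (Sec S U)) = piIn K (Sec T V) :=
    secMap_algebraMap g U V h K.π
  rw [hπ] at hmap
  exact hmap

/-- A homomorphism from the chart ring to `Γ(T, V)` is determined by the submodules that it
defines, so homomorphisms with matching submodules are compatible with restriction. -/
theorem secMap_comp_eq {T : Over (Base O F)} {V W : T.left.Opens}
    (hW : W ≤ (𝟙 T : T ⟶ T).left ⁻¹ᵁ V)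
    {φ : ChartRing K.π i →+* Sec T V} {ψ : ChartRing K.π i →+* Sec T W}
    (hφ : φ.comp (algebraMap (IntRing O F) (ChartRing K.π i)) =
      algebraMap (IntRing O F) (Sec T V))
    (hψ : ψ.comp (algebraMap (IntRing O F) (ChartRing K.π i)) =
      algebraMap (IntRing O F) (Sec T W))
    (hV' : IsChartDatum (piIn K (Sec T V)) i ((univD K.π i).map φ) ((univY K.π i).map φ))
    (hW' : IsChartDatum (piIn K (Sec T W)) i ((univD K.π i).map ψ) ((univY K.π i).map ψ))
    (h0 : colSpan K (piIn K (Sec T W) • (univY K.π i).map ψ) ((univY K.π i).map ψ) =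
      extend K m (secMap (𝟙 T) V W hW)
        (colSpan K (piIn K (Sec T V) • (univY K.π i).map φ) ((univY K.π i).map φ)))
    (h1 : colSpan K (upperBlock (piIn K (Sec T W)) ((univD K.π i).map ψ)
        ((univY K.π i).map ψ)) 1 =
      extend K m (secMap (𝟙 T) V W hW) (colSpan K (upperBlock (piIn K (Sec T V))
        ((univD K.π i).map φ) ((univY K.π i).map φ)) 1)) :
    (secMap (𝟙 T) V W hW : Sec T V →+* Sec T W).comp φ = ψ := by
  have hπ := secMap_algebraMap (𝟙 T) V W hW K.π
  rw [extend_chart_F0 K _ hπ] at h0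
  rw [extend_chart_F1 K _ hπ] at h1
  obtain ⟨hD, hY⟩ := (hV'.map_secMap (𝟙 T) hW).ext K hW' h0.symm h1.symm
  refine chartRing_hom_ext ?_ ?_ ?_
  · rw [RingHom.comp_assoc, hφ, hψ]
    exact RingHom.ext fun a => secMap_algebraMap (𝟙 T) V W hW a
  · rw [← hD, Matrix.map_map]
    rfl
  · rw [← hY, Matrix.map_map]
    rfl

/-- Local chart data compatible with restriction come from a morphism to the chart. -/
theorem exists_hom_of_isChartDatum {T : Over (Base O F)}
    (N₀ N₁ : ∀ V : T.left.affineOpens, Submodule (Sec T V.1) (LatticeOver K m (Sec T V.1)))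
    (hN₀ : ∀ (V W : T.left.affineOpens) (hW : W.1 ≤ (𝟙 T : T ⟶ T).left ⁻¹ᵁ V.1),
      N₀ W = extend K m (secMap (𝟙 T) V.1 W.1 hW) (N₀ V))
    (hN₁ : ∀ (V W : T.left.affineOpens) (hW : W.1 ≤ (𝟙 T : T ⟶ T).left ⁻¹ᵁ V.1),
      N₁ W = extend K m (secMap (𝟙 T) V.1 W.1 hW) (N₁ V))
    (hd : ∀ V : T.left.affineOpens, ∃ D Y, IsChartDatum (piIn K (Sec T V.1)) i D Y ∧
      N₀ V = colSpan K (piIn K (Sec T V.1) • Y) Y ∧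
      N₁ V = colSpan K (upperBlock (piIn K (Sec T V.1)) D Y) 1) :
    ∃ h : T ⟶ chartScheme K.π i, ∀ V : T.left.affineOpens,
      N₀ V = ((chartFamily h).pt V).F0 ∧ N₁ V = ((chartFamily h).pt V).F1 := by
  have hd' : ∀ V : T.left.affineOpens, ∃ φ : ChartRing K.π i →+* Sec T V.1,
      φ.comp (algebraMap (IntRing O F) (ChartRing K.π i)) =
        algebraMap (IntRing O F) (Sec T V.1) ∧
      IsChartDatum (piIn K (Sec T V.1)) i ((univD K.π i).map φ) ((univY K.π i).map φ) ∧
      N₀ V = colSpan K (piIn K (Sec T V.1) • (univY K.π i).map φ) ((univY K.π i).map φ) ∧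
      N₁ V = colSpan K (upperBlock (piIn K (Sec T V.1)) ((univD K.π i).map φ)
        ((univY K.π i).map φ)) 1 := by
    intro V
    obtain ⟨D, Y, hDY, h0, h1⟩ := hd V
    obtain ⟨φ, hφ, rfl, rfl⟩ := exists_chartRing_lift
      (algebraMap (IntRing O F) (Sec T V.1)) (ϖ := K.π) hDY
    exact ⟨φ, hφ, hDY, h0, h1⟩
  choose φ hφ hDY h0 h1 using hd'
  obtain ⟨h, hh⟩ := exists_hom_of_coordMaps φ hφ fun V W hW =>
    secMap_comp_eq hW (hφ V) (hφ W) (hDY V) (hDY W)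
      ((h0 W).symm.trans ((hN₀ V W hW).trans (congrArg _ (h0 V))))
      ((h1 W).symm.trans ((hN₁ V W hW).trans (congrArg _ (h1 V))))
  refine ⟨h, fun V => ?_⟩
  rw [h0, h1, ← hh]
  exact ⟨rfl, rfl⟩

theorem exists_hom_of_inChart {T : Over (Base O F)} {x : SplittingFamily K m s T}
    (hx : InChart i x) : ∃ h : T ⟶ chartScheme K.π i, ∀ V : T.left.affineOpens,
      (x.pt V).F0 = ((chartFamily h).pt V).F0 ∧ (x.pt V).F1 = ((chartFamily h).pt V).F1 :=
  exists_hom_of_isChartDatum (fun V => (x.pt V).F0) (fun V => (x.pt V).F1) x.F0_res x.F1_res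
    fun V => (x.pt V).exists_isChartDatum K (hx V).1 (hx V).2

variable (K i) in
/-- The universal point over the chart. -/
noncomputable def chartUniversal : SplittingFamily K m s (chartScheme K.π i) :=
  chartFamily (𝟙 _)

theorem isPullbackOf_chartUniversal {T : Over (Base O F)} (h : T ⟶ chartScheme K.π i) :
    IsPullbackOf h (chartUniversal K i) (chartFamily h) := by
  have := isPullbackOf_chartFamily (𝟙 _) h
  rwa [Category.comp_id] at this

theorem IsPullbackOf.congr_right {S T : Over (Base O F)} {g : T ⟶ S}
    {y : SplittingFamily K m s S} {x x' : SplittingFamily K m s T} (h : IsPullbackOf g y x)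
    (e : ∀ V, (x'.pt V).F0 = (x.pt V).F0 ∧ (x'.pt V).F1 = (x.pt V).F1) : IsPullbackOf g y x' :=
  fun U V hV => ⟨(e V).1.trans (h U V hV).1, (e V).2.trans (h U V hV).2⟩

/-- The chart represents the subfunctor of points that satisfy the chart condition. -/
theorem existsUnique_hom_of_inChart {T : Over (Base O F)} {x : SplittingFamily K m s T}
    (hx : InChart i x) : ∃! h : T ⟶ chartScheme K.π i, IsPullbackOf h (chartUniversal K i) x := by
  obtain ⟨h, hh⟩ := exists_hom_of_inChart hx
  refine ⟨h, (isPullbackOf_chartUniversal h).congr_right hh, fun h' hh' => ?_⟩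
  refine chartFamily_injective fun V => ?_
  have := (isPullbackOf_chartUniversal h').unique hh' V
  exact ⟨this.1.trans (hh V).1, this.2.trans (hh V).2⟩

theorem IsPullbackOf.inChart {S T : Over (Base O F)} {g : T ⟶ S}
    {y : SplittingFamily K m s S} {x : SplittingFamily K m s T} (h : IsPullbackOf g y x)
    (hy : InChart i y) : InChart i x := by
  rw [inChart_iff] at hy ⊢
  exact fun t => (h.mem_chartLocus_iff i t).2 (hy _)

/-! ### The chart as an open subscheme -/

/-- The chart locus of a family on `S`, as an open subscheme. -/
noncomputable def chartOpens (i : Fin s ↪ Fin (2 * m)) {S : Over (Base O F)}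
    (y : SplittingFamily K m s S) : S.left.Opens := ⟨chartLocus i y, isOpen_chartLocus i y⟩

/-- An open subscheme `W` of `S`, as a scheme over `Spec O_F`. -/
noncomputable def opensOver {S : Over (Base O F)} (W : S.left.Opens) : Over (Base O F) :=
  Over.mk (W.ι ≫ S.hom)

/-- The inclusion of an open subscheme. -/
noncomputable def opensOverι {S : Over (Base O F)} (W : S.left.Opens) : opensOver W ⟶ S :=
  Over.homMk W.ι rfl

instance isOpenImmersion_opensOverι {S : Over (Base O F)} (W : S.left.Opens) :
    IsOpenImmersion (opensOverι W).left :=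
  inferInstanceAs (IsOpenImmersion W.ι)

theorem range_opensOverι {S : Over (Base O F)} (W : S.left.Opens) :
    Set.range (opensOverι W).left = (W : Set S.left) :=
  Scheme.Opens.range_ι W

/-- The restriction of a family on `S` to an open subscheme of its chart locus is pulled back from
the chart. For an affine open `V` of `T`, the submodules are read off over the affine open `g V` of
`S`. -/
theorem exists_hom_of_isOpenImmersion {T S : Over (Base O F)} (g : T ⟶ S)
    [IsOpenImmersion g.left] (y : SplittingFamily K m s S)
    (hy : ∀ t : T.left, g.left t ∈ chartLocus i y) :
    ∃ h : T ⟶ chartScheme K.π i, IsPullbackOf g y (chartFamily h) := by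
  let im : T.left.affineOpens → S.left.affineOpens :=
    fun V => ⟨g.left ''ᵁ V.1, V.2.image_of_isOpenImmersion g.left⟩
  have him : ∀ V : T.left.affineOpens, V.1 ≤ g.left ⁻¹ᵁ (im V).1 :=
    fun V p hp => ⟨p, hp, rfl⟩
  have hmono : ∀ V V' : T.left.affineOpens, V'.1 ≤ (𝟙 T : T ⟶ T).left ⁻¹ᵁ V.1 →
      (im V').1 ≤ (𝟙 S : S ⟶ S).left ⁻¹ᵁ (im V).1 := by
    rintro V V' hV _ ⟨p, hp, rfl⟩
    exact ⟨p, hV hp, rfl⟩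
  have hres : ∀ (N : ∀ U : S.left.affineOpens,
      Submodule (Sec S U.1) (LatticeOver K m (Sec S U.1)))
      (_ : ∀ (U V : S.left.affineOpens) (h : V.1 ≤ (𝟙 S : S ⟶ S).left ⁻¹ᵁ U.1),
        N V = extend K m (secMap (𝟙 S) U.1 V.1 h) (N U))
      (V V' : T.left.affineOpens) (hV : V'.1 ≤ (𝟙 T : T ⟶ T).left ⁻¹ᵁ V.1),
      extend K m (secMap g (im V').1 V'.1 (him V')) (N (im V')) =
        extend K m (secMap (𝟙 T) V.1 V'.1 hV)
          (extend K m (secMap g (im V).1 V.1 (him V)) (N (im V))) := by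
    intro N hN V V' hV
    have hle : V'.1 ≤ g.left ⁻¹ᵁ (im V).1 := fun p hp => him V (hV hp)
    rw [hN (im V) (im V') (hmono V V' hV),
      extend_secMap_comp (𝟙 S) g (hmono V V' hV) (him V') g (Category.comp_id g) hle,
      extend_secMap_comp g (𝟙 T) (him V) hV g (Category.id_comp g) hle]
  have hchart : ∀ V : T.left.affineOpens,
      IsCompl (y.pt (im V)).F1 (upperSpan K m (Sec S (im V).1)) ∧
      IsCompl (y.pt (im V)).F0 (minorSpan K m i (Sec S (im V).1)) := by
    intro V
    refine (isCompl_iff_inChartAt i y (im V)).2 fun t ht => ?_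
    rw [← mem_chartLocus_iff]
    obtain ⟨p, -, rfl⟩ := ht
    exact hy p
  obtain ⟨h, hh⟩ := exists_hom_of_isChartDatum (K := K) (i := i)
    (fun V => extend K m (secMap g (im V).1 V.1 (him V)) (y.pt (im V)).F0)
    (fun V => extend K m (secMap g (im V).1 V.1 (him V)) (y.pt (im V)).F1)
    (hres (fun U => (y.pt U).F0) y.F0_res) (hres (fun U => (y.pt U).F1) y.F1_res) (by
      intro V
      obtain ⟨D, Y, hDY, e0, e1⟩ :=
        (y.pt (im V)).exists_isChartDatum K (hchart V).1 (hchart V).2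
      have hπ := secMap_algebraMap g (im V).1 V.1 (him V) K.π
      exact ⟨_, _, hDY.map_secMap g (him V), by rw [e0, extend_chart_F0 K _ hπ],
        by rw [e1, extend_chart_F1 K _ hπ]⟩)
  refine ⟨h, isPullbackOf_of_locally _ _ _ fun t => ?_⟩
  obtain ⟨V, ht, -⟩ := exists_affine_nhds T (U := ⊤) (t := t) trivial
  exact ⟨im V, V, him V, ht, (hh V).1.symm, (hh V).2.symm⟩

/-- Let `T` be the open subscheme of the model `M` formed by the chart locus. The chart maps to
`T` because the universal point over it satisfies the chart condition, and `T` maps to the chart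
by `exists_hom_of_isOpenImmersion`. The uniqueness of classifying morphisms shows that these maps
are mutually inverse. -/
theorem isOpenImmersion_of_isPullbackOf {M T : Over (Base O F)} {ξ : SplittingFamily K m s M}
    (hM : IsNaiveSplittingModel M ξ) (g : T ⟶ M) [IsOpenImmersion g.left]
    (hg : Set.range g.left = chartLocus i ξ) {j : chartScheme K.π i ⟶ M}
    (hj : IsPullbackOf j ξ (chartUniversal K i)) : IsOpenImmersion j.left := by
  obtain ⟨h, hh⟩ := exists_hom_of_isOpenImmersion (i := i) g ξ fun t => hg ▸ ⟨t, rfl⟩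
  have hrange : Set.range j.left ⊆ Set.range g.left := by
    rw [hg]
    rintro _ ⟨p, rfl⟩
    exact (hj.mem_chartLocus_iff i p).1 ((inChart_iff i _).1 (inChart_chartFamily _) p)
  let k : chartScheme K.π i ⟶ T :=
    Over.homMk (IsOpenImmersion.lift g.left j.left hrange) (by
      rw [← Over.w g, IsOpenImmersion.lift_fac_assoc]
      exact Over.w j)
  have hkg : k ≫ g = j :=
    Over.OverMorphism.ext (IsOpenImmersion.lift_fac g.left j.left hrange)
  have hkh : k ≫ h = 𝟙 _ := by
    refine chartFamily_injective fun V => ?_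
    have h1 : IsPullbackOf j ξ (chartFamily (k ≫ h)) :=
      hkg ▸ hh.comp (isPullbackOf_chartFamily h k)
    exact h1.unique hj V
  have hhk : h ≫ k = 𝟙 _ := by
    have h1 : IsPullbackOf (h ≫ j) ξ (chartFamily h) :=
      hj.comp (isPullbackOf_chartUniversal h)
    have h2 : h ≫ j = g := (hM _ (chartFamily h)).unique h1 hh
    have h3 : (h ≫ k).left ≫ g.left = (𝟙 T : T ⟶ T).left ≫ g.left := by
      rw [← Over.comp_left, ← Over.comp_left, Category.assoc, hkg, h2, Category.id_comp]
    exact Over.OverMorphism.ext ((cancel_mono g.left).1 h3)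
  have hk : IsIso k := ⟨h, hkh, hhk⟩
  have hk' : IsIso k.left := inferInstanceAs (IsIso ((Over.forget _).map k))
  rw [← hkg, Over.comp_left]
  infer_instance

theorem exists_isOpenImmersion {M : Over (Base O F)} {ξ : SplittingFamily K m s M}
    (hM : IsNaiveSplittingModel M ξ) :
    ∃ j : chartScheme K.π i ⟶ M, IsOpenImmersion j.left ∧
      IsPullbackOf j ξ (chartUniversal K i) := by
  obtain ⟨j, hj, -⟩ := hM _ (chartUniversal K i)
  exact ⟨j, isOpenImmersion_of_isPullbackOf hM (opensOverι (chartOpens i ξ))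
    (range_opensOverι _) hj, hj⟩

/-! ### The points with `F_1 = t Λ` over fields -/

theorem isField_sec_top {κ : Type u} [Field κ] (f : IntRing O F →+* κ) :
    IsField (Sec (specField f) ⊤) := by
  have e : Sec (specField f) ⊤ ≃+* κ :=
    (Scheme.ΓSpecIso (CommRingCat.of κ)).commRingCatIsoToRingEquiv
  exact e.toMulEquiv.isField (Field.toIsField κ)

/-- A point `(F_0, t Λ)` over a field lies in some chart. -/
theorem exists_inChart_of_isTLattice (hm : 0 < m) {κ : Type u} [Field κ] (f : IntRing O F →+* κ)
    (x : SplittingFamily K m s (specField f)) (hx : IsTLattice x) :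
    ∃ i : Fin s ↪ Fin (2 * m), InChart i x := by
  let U : (specField f).left.affineOpens := ⟨⊤, isAffineOpen_top (Spec (CommRingCat.of κ))⟩
  obtain ⟨i, hi⟩ := (x.pt U).exists_isCompl_minorSpan K (isField_sec_top f)
  have h1 := isCompl_upperSpan_of_eq_range K hm (x.pt U) (hx U)
  refine ⟨i, (inChart_iff i x).2 fun t => ?_⟩
  exact ⟨U, trivial, (isCompl_iff_inChartAt i x U).1 ⟨h1, hi⟩ t trivial⟩

/-- When `π = 0`, the datum `D = 0` with the standard columns `e_{i_1}, …, e_{i_s}` as `Y` has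
`X = 0`, that is, `F_1 = t Λ`. -/
theorem exists_isTLattice_inChart {κ : Type u} [Field κ] (f : IntRing O F →+* κ)
    (hf : f K.π = 0) (i : Fin s ↪ Fin (2 * m)) :
    ∃ x : SplittingFamily K m s (specField f), IsTLattice x ∧ InChart i x := by
  have h0 : IsChartDatum (f K.π) i (0 : Matrix (Fin s) (Fin s) κ)
      ((1 : Matrix (Fin (2 * m)) (Fin (2 * m)) κ).submatrix id i) := by
    refine ⟨?_, by simp, by simp [hf]⟩
    ext a b
    simp [Matrix.one_apply]
  obtain ⟨φ, hφ, hφD, -⟩ := exists_chartRing_lift f h0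
  let h : specField f ⟶ chartScheme K.π i :=
    Over.homMk (Spec.map (CommRingCat.ofHom φ)) (by
      change Spec.map _ ≫ Spec.map _ = Spec.map _
      rw [← Spec.map_comp, ← CommRingCat.ofHom_comp, hφ])
  refine ⟨chartFamily h, fun U => ?_, inChart_chartFamily h⟩
  have hπ : piIn K (Sec (specField f) U.1) = 0 := by
    have h1 := comp_appLE_eq (R := CommRingCat.of κ) (CommRingCat.ofHom f) (𝟙 _)
      (str (specField f)) (Category.id_comp _) U.1 (fun _ _ => trivial) (fun _ _ => trivial)
    have h2 := congrArg (fun a => a.hom K.π) h1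
    refine Eq.trans h2.symm ?_
    rw [CommRingCat.hom_comp, RingHom.comp_apply, CommRingCat.hom_ofHom, hf, map_zero]
    rfl
  have hD : (univD K.π i).map (coordMap h U.1) = 0 := by
    obtain ⟨ψ, hψ⟩ : ∃ ψ : κ →+* Sec (specField f) U.1, coordMap h U.1 = ψ.comp φ :=
      ⟨_, (congrArg CommRingCat.Hom.hom (comp_appLE_eq (R := CommRingCat.of κ)
        (CommRingCat.ofHom φ) (𝟙 _) h.left (Category.id_comp _) U.1 (fun _ _ => trivial)
        (fun _ _ => trivial))).symm⟩
    rw [hψ, RingHom.coe_comp, ← Matrix.map_map, hφD]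
    exact Matrix.map_zero _ (map_zero ψ)
  have hX : upperBlock (piIn K (Sec (specField f) U.1)) ((univD K.π i).map (coordMap h U.1))
      ((univY K.π i).map (coordMap h U.1)) = 0 := by
    rw [upperBlock, hD, hπ]
    simp
  change colSpan K (upperBlock _ _ _) 1 = _
  rw [hX, colSpan_zero_one]
  rw [algebraMap_π₀ K, hπ]
  ring

end ChartFamily

end NaiveSplitting

theorem theorem4p2 {O F₀ F : Type u}
    [CommRing O] [IsDomain O] [IsDiscreteValuationRing O] [Field F₀] [Algebra O F₀]
    [IsFractionRing O F₀] [Field F] [Algebra F₀ F] [Algebra O F] [IsScalarTower O F₀ F]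
    (K : RamifiedQuadratic O F₀ F)
    (m r s : ℕ) (hm : 3 < 2 * m) (hrs : r + s = 2 * m) (hsr : s ≤ r) :
    -- every point `(F_0, t Λ_m)` of the model lies in one of the charts
    (∀ (κ : Type u) [Field κ] (f : IntRing O F →+* κ) (x : SplittingFamily K m s (specField f)),
        IsTLattice x → ∃ i : Fin s ↪ Fin (2 * m), InChart i x) ∧
    -- for every choice of the rows of `Y'`, the scheme `U = Spec O_F[D, Y] / I` is a chart
    ∀ i : Fin s ↪ Fin (2 * m),
      -- the condition defining the chart holds at some point `(F_0, t Λ_m)`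
      (∀ (κ : Type u) [Field κ] (f : IntRing O F →+* κ), f K.π = 0 →
        ∃ x : SplittingFamily K m s (specField f), IsTLattice x ∧ InChart i x) ∧
      -- this condition is open
      (∀ (S : Over (Base O F)) (y : SplittingFamily K m s S),
        ∃ W : S.left.Opens, ∀ (T : Over (Base O F)) (g : T ⟶ S) (x : SplittingFamily K m s T),
          IsPullbackOf g y x → (InChart i x ↔ Set.range g.left ⊆ (W : Set S.left))) ∧
      ∃ u : SplittingFamily K m s (chartScheme K.π i),
        -- `U`, with the universal point `u`, represents the subfunctor defined by the condition
        (∀ (T : Over (Base O F)) (x : SplittingFamily K m s T),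
          (InChart i x → ∃! h : T ⟶ chartScheme K.π i, IsPullbackOf h u x) ∧
          ((∃ h : T ⟶ chartScheme K.π i, IsPullbackOf h u x) → InChart i x)) ∧
        -- `U` is, through `u`, an open subscheme of the naive splitting model `M`
        (∀ (M : Over (Base O F)) (ξ : SplittingFamily K m s M), IsNaiveSplittingModel M ξ →
          ∃ j : chartScheme K.π i ⟶ M, IsOpenImmersion j.left ∧ IsPullbackOf j ξ u) := by
  refine ⟨fun κ _ f x hx => exists_inChart_of_isTLattice (by omega) f x hx, fun i =>
    ⟨fun κ _ f hf => exists_isTLattice_inChart f hf i, fun S y => ⟨chartOpens i y, ?_⟩,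
      chartUniversal K i, fun T x => ⟨existsUnique_hom_of_inChart, ?_⟩,
      fun M ξ hM => exists_isOpenImmersion hM⟩⟩
  · intro T g x hx
    rw [inChart_iff, Set.range_subset_iff]
    exact forall_congr' fun t => hx.mem_chartLocus_iff i t
  · rintro ⟨h, hh⟩
    exact hh.inChart (inChart_chartFamily _)
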